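/- Consider a discrete memoryless channel with finite input alphabet $\mathcal X$, finite output alphabet $\mathcal Y$ and transition probabilities $W(y|x)>0$ for all $x,y$. Put $W_x=W(\cdot|x)$, $\lambda=\min_{x,y}W(y|x)$ and $D=\max_{x,\tilde x}D(W_x\|W_{\tilde x})$, let $I(p,W)$ be the mutual information for the input distribution $p$, let $C=\max_p I(p,W)$ be the capacity, and for $R\le C$ let $$J(R)=\max\Bigl\{\alpha D(q_1\|W_{x_1})+(1-\alpha)D(q_2\|W_{x_2})\Bigr\},$$ the maximum being over $0\le\alpha\le1$, $x_1,x_2\in\mathcal X$ and input distributions $p_1,p_2$ with $\alpha I(p_1,W)+(1-\alpha)I(p_2,W)\ge R$, where $q_i(y)=\sum_x W(y|x)p_i(x)$. All logarithms are natural. A variable-length block code (with feedback) with finite message set $\mathcal M$ consists of: a decoding time $\tau\in\{1,2,\ldots,\infty\}$, which is a Markov time with respect to the channel outputs $Y_1,Y_2,\ldots$; an encoder, which determines the input at time $t+1$ (for $t<\tau$) from the message and the outputs $Y^t$; and a decoder, which maps $Y^\tau$ to a decoded message $\hat M$. The message $M$ is uniformly distributed on $\mathcal M$, and $\Pr[\tau<\infty]=1$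 is required; $\mathbb E[\tau]=\infty$ is allowed. Let $P_e=\Pr[\hat M\ne M]$ and $P_e(m)=\Pr[\hat M\neq M\mid M=m]$, and $$R=\frac{\ln|\mathcal M|}{\mathbb E[\tau]},\qquad E=\frac{-\ln P_e}{\mathbb E[\tau]},$$ where a quotient with denominator $\mathbb E[\tau]=\infty$ is $0$. For every such code and every $\delta>0$ with $P_e+\delta+\frac{P_e}{\delta}+\frac1{|\mathcal M|}\le\frac12$, define $$\epsilon_1=P_e+\delta+\frac{P_e}{\delta}+\frac1{|\mathcal M|},\qquad \epsilon_2=\frac{h(\epsilon_1)-\ln(\lambda\delta)}{\mathbb E[\tau]},\qquad \epsilon=\frac{\epsilon_1D+\epsilon_2}{1-\epsilon_1},$$ where $h(s)=-s\ln s-(1-s)\ln(1-s)$. Then $P_e>0$, $D>0$, $1-\frac{E-\epsilon}{D}>0$ and $\frac{R-\epsilon}{1-(E-\epsilon)/D}\le C$ (so that all terms below are well defined), and every message $m\in\mathcal M$ satisfies $P_e(m)>0$ and $$\frac{-\ln P_e(m)}{\mathbb E[\tau]}\le E+\Bigl(1-\frac{E-\epsilon}{D}\Bigr)J\Bigl(\frac{R-\epsilon}{1-\frac{E-\epsilon}{D}}\Bigr).$$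 -/

import Mathlib

open scoped BigOperators ENNReal

noncomputable section

namespace UEP

/-- A discrete memoryless channel with finite input alphabet `X` and finite output alphabet `Y`,
all of whose transition probabilities are positive: `W.prob x y = W(y|x)`. -/
structure DMC (X Y : Type*) [Fintype X] [Fintype Y] where
  prob : X → Y → ℝ
  pos : ∀ x y, 0 < prob x y
  sum_eq_one : ∀ x, ∑ y, prob x y = 1

section Channel

variable {X Y : Type*} [Fintype X] [Fintype Y]

/-- Kullback-Leibler divergence (in nats) of two probability mass functions on a finite set.
It is only used for a second argument with full support. -/
def kl (p q : Y → ℝ) : ℝ := ∑ y, p y * Real.log (p y / q y)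

/-- The output distribution `∑ x, p(x) W(·|x)` for the input distribution `p`. -/
def DMC.out (W : DMC X Y) (p : X → ℝ) (y : Y) : ℝ := ∑ x, p x * W.prob x y

/-- The mutual information `I(p, W)` (in nats). -/
def DMC.mutualInfo (W : DMC X Y) (p : X → ℝ) : ℝ :=
  ∑ x, ∑ y, p x * W.prob x y * Real.log (W.prob x y / W.out p y)

/-- The smallest transition probability `λ`. -/
def DMC.minProb (W : DMC X Y) : ℝ := ⨅ q : X × Y, W.prob q.1 q.2

/-- The channel capacity `C`. -/
def DMC.capacity (W : DMC X Y) : ℝ := sSup (W.mutualInfo '' stdSimplex ℝ X)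

/-- `D`, the largest divergence between the output distributions of two input letters. -/
def DMC.maxDiv (W : DMC X Y) : ℝ := ⨆ q : X × X, kl (W.prob q.1) (W.prob q.2)

/-- The function `J`. For `R ≤ W.capacity` the set is nonempty and compact, so that the supremum
is a maximum; larger `R` are outside the domain of `J`. -/
def DMC.J (W : DMC X Y) (R : ℝ) : ℝ :=
  sSup {v : ℝ | ∃ (α : ℝ) (x₁ x₂ : X) (p₁ p₂ : X → ℝ),
    0 ≤ α ∧ α ≤ 1 ∧ p₁ ∈ stdSimplex ℝ X ∧ p₂ ∈ stdSimplex ℝ X ∧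
    R ≤ α * W.mutualInfo p₁ + (1 - α) * W.mutualInfo p₂ ∧
    v = α * kl (W.out p₁) (W.prob x₁) + (1 - α) * kl (W.out p₂) (W.prob x₂)}

end Channel

/-- A Markov time with respect to a sequence of `Y`-valued letters; `y i` is the letter at time
`i + 1`. Whether the time equals `t` is determined by the first `t` letters. -/
structure MarkovTime (Y : Type*) where
  time : (ℕ → Y) → ℕ∞
  one_le : ∀ y, 1 ≤ time y
  markov : ∀ (t : ℕ) (y y' : ℕ → Y), (∀ i < t, y i = y' i) → time y = t → time y' = t

/-- The word `w` of length `t` is one at whose end the Markov time is reached. -/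
def MarkovTime.StopsAt {Y : Type*} (τ : MarkovTime Y) (t : ℕ) (w : Fin t → Y) : Prop :=
  ∀ y : ℕ → Y, (∀ i : Fin t, y i = w i) → τ.time y = t

section Code

variable {X Y M : Type*} [Fintype X] [Fintype Y] [Fintype M]

/-- The probability that the first `t` outputs are `w` when the input letter at time `i + 1` is
`f i` applied to the first `i` outputs. -/
def DMC.wordProb (W : DMC X Y) (f : (t : ℕ) → (Fin t → Y) → X) (t : ℕ) (w : Fin t → Y) : ℝ :=
  ∏ i : Fin t, W.prob (f i (fun j : Fin i => w (Fin.castLE i.is_lt.le j))) (w i)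

open scoped Classical in
/-- The probability that the (uniformly distributed) message is `m`, that the Markov time `τ`
equals `t`, and that the first `t` outputs are `w`. -/
def DMC.jointProb (W : DMC X Y) (τ : MarkovTime Y) (enc : M → (t : ℕ) → (Fin t → Y) → X)
    (m : M) (t : ℕ) (w : Fin t → Y) : ℝ :=
  if τ.StopsAt t w then (Fintype.card M : ℝ)⁻¹ * W.wordProb (enc m) t w else 0

/-- A variable length block code (with feedback) with message set `M` on the channel `W`. The
values of `enc` after the decoding time, and those of `dec` at words at whose end the decoding
time is not reached, play no role. -/
structure VLCode (W : DMC X Y) (M : Type*) [Fintype M] where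
  /-- the decoding time -/
  τ : MarkovTime Y
  /-- the encoding scheme: the input letter at time `t + 1`, given the message and `t` outputs -/
  enc : M → (t : ℕ) → (Fin t → Y) → X
  /-- the decoding rule -/
  dec : (t : ℕ) → (Fin t → Y) → M
  /-- the decoding time is finite with probability one -/
  finite_time : HasSum (fun t : ℕ => ∑ w : Fin t → Y, ∑ m, W.jointProb τ enc m t w) 1

namespace VLCode

variable {W : DMC X Y} (c : VLCode W M)

open scoped Classical in
/-- The probability of an event given in terms of the message, the decoding time and the outputs
up to the decoding time. -/
def Pr (S : M → (t : ℕ) → (Fin t → Y) → Prop) : ℝ :=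
  ∑' t : ℕ, ∑ w : Fin t → Y, ∑ m, if S m t w then W.jointProb c.τ c.enc m t w else 0

/-- The expected decoding time, which may be infinite. -/
def expTime : ℝ≥0∞ :=
  ∑' t : ℕ, (t : ℝ≥0∞) *
    ENNReal.ofReal (∑ w : Fin t → Y, ∑ m, W.jointProb c.τ c.enc m t w)

/-- `a / E[τ]`, which is `0` if `E[τ] = ∞`. -/
def perTime (a : ℝ) : ℝ := a * (c.expTime⁻¹).toReal

/-- The error probability: the decoded message differs from the transmitted one. -/
def Pe : ℝ := c.Pr fun m t w => c.dec t w ≠ m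

/-- The conditional error probability given that the message `m` is transmitted. -/
def PeOf (m : M) : ℝ :=
  c.Pr (fun m' t w => c.dec t w ≠ m' ∧ m' = m) / c.Pr (fun m' _ _ => m' = m)

/-- The rate `R = ln |M| / E[τ]`. -/
def rate : ℝ := c.perTime (Real.log (Fintype.card M))

/-- The error exponent `E = - ln Pe / E[τ]`. -/
def exponent : ℝ := c.perTime (-Real.log c.Pe)

def eps₁ (δ : ℝ) : ℝ := c.Pe + δ + c.Pe / δ + (Fintype.card M : ℝ)⁻¹

def eps₂ (δ : ℝ) : ℝ :=
  c.perTime (Real.binEntropy (c.eps₁ δ) - Real.log (W.minProb * δ))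

def eps (δ : ℝ) : ℝ := (c.eps₁ δ * W.maxDiv + c.eps₂ δ) / (1 - c.eps₁ δ)

end VLCode

end Code

end UEP

end

open scoped BigOperators ENNReal

noncomputable section

namespace UEP

/-! ### Mixtures of two points of the plane. -/

section Planar

/-! Cut the transmission at the first time some message has posterior probability at least `1 - δ`
(the message is then locked, for good). Let T = E[τ] be finite, and let N₁ and N₂ be the expected
times spent before and after locking, so that N₁ + N₂ = T.

Before locking, the posterior entropy of the message must fall from ln|M| to a small value. Its
expected decrease in one step is a mutual information, so the information I gathered in this phase
is at least about ln|M| (`log_card_mul_le_sum_mutualInfo`). After locking, deciding reliably is a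
binary test between the locked message and all others. At locking its log-likelihood ratio is at
most -ln(λδ), and each step adds at most D, so -ln Pe is at most about D N₂ (`lockedTest_le`).
Finally, the decoder rejects a fixed `m` with probability near 1 under the average output law but
with probability Pe(m) under the law given `m`. Hence -ln Pe(m) is at most about the divergence
between these laws, which is at most G + D N₂, where G is the part gathered before locking
(`averageTest_le`).

The pair (I/N₁, G/N₁) is a mean of pairs (I(p,W), D(q‖W_x)). In the plane such a mean is dominated
by a mixture of two of the pairs, which is why J needs only two of them. The dominated set is convex
and closed, so this persists for infinitely many words, and G ≤ N₁ J(I/N₁). Since (0, D) is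
dominated too, replacing N₂/T by its lower bound (E - ε)/D does not hurt (`DMC.phase_tradeoff`); ε
is built to absorb all error terms.

Each process is a function on words already weighted by probability, and optional stopping becomes
an exact identity on finite trees (`leafSum_eq`). Entropy and data-processing inequalities are
replaced by tangent lines of x ln(x/y) (`mul_log_div_ge`), which can be summed before the truncation
length tends to infinity. If E[τ] = ∞, all quotients vanish and only the tradeoff is needed. -/

/-- Any weighted mean in the plane is dominated by a mixture of two of the points. -/
theorem exists_pair_dominating_mean {ι : Type*} (a b : ι → ℝ) :
    ∀ (n : ℕ) (s : Finset ι) (w : ι → ℝ), s.card = n → (∀ i ∈ s, 0 ≤ w i) → ∑ i ∈ s, w i = 1 →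
      ∃ i ∈ s, ∃ j ∈ s, ∃ α : ℝ, 0 ≤ α ∧ α ≤ 1 ∧
        ∑ i ∈ s, w i * a i ≤ α * a i + (1 - α) * a j ∧
        ∑ i ∈ s, w i * b i ≤ α * b i + (1 - α) * b j := by
  classical
  intro n
  induction n using Nat.strong_induction_on with
  | _ n ih =>
  intro s w hn hw hsum
  by_cases hcard : s.card ≤ 2
  · interval_cases hc : s.card
    · rw [Finset.card_eq_zero] at hc
      simp [hc] at hsum
    · obtain ⟨i, rfl⟩ := Finset.card_eq_one.1 hc
      simp only [Finset.sum_singleton] at hsum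
      refine ⟨i, by simp, i, by simp, 1, by norm_num, le_rfl, ?_, ?_⟩ <;> simp [hsum]
    · obtain ⟨i, j, hij, rfl⟩ := Finset.card_eq_two.1 hc
      rw [Finset.sum_pair hij] at hsum
      have hi := hw i (by simp)
      have hj := hw j (by simp)
      have : w j = 1 - w i := by linarith
      refine ⟨i, by simp, j, by simp, w i, hi, by linarith, ?_, ?_⟩ <;>
        rw [Finset.sum_pair hij, this]
  · push Not at hcard
    -- Two linear constraints on at least three weights leave a nonzero direction; its sign is
    -- chosen so that moving along it does not lower the second mean.
    obtain ⟨d, hd0, hdsum, hda, hdb⟩ : ∃ d : ι → ℝ, (∃ i ∈ s, d i ≠ 0) ∧ ∑ i ∈ s, d i = 0 ∧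
        ∑ i ∈ s, d i * a i = 0 ∧ 0 ≤ ∑ i ∈ s, d i * b i := by
      let f : (s → ℝ) →ₗ[ℝ] ℝ × ℝ :=
        { toFun := fun d => (∑ i, d i, ∑ i, d i * a i)
          map_add' := fun x y => by simp [Finset.sum_add_distrib, add_mul]
          map_smul' := fun r x => by simp [Finset.mul_sum, mul_assoc] }
      have hker : LinearMap.ker f ≠ ⊥ := by
        apply LinearMap.ker_ne_bot_of_finrank_lt
        simp only [Module.finrank_prod, Module.finrank_self, Module.finrank_fintype_fun_eq_card,
          Fintype.card_coe]
        omega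
      obtain ⟨d, hd, hd0⟩ := Submodule.exists_mem_ne_zero_of_ne_bot hker
      have hd' : (∑ i, d i, ∑ i, d i * a i) = ((0, 0) : ℝ × ℝ) := hd
      rw [Prod.mk.injEq] at hd'
      obtain ⟨i, hi⟩ := Function.ne_iff.1 hd0
      have key : ∀ g : ι → ℝ, ∑ i ∈ s, (if h : i ∈ s then d ⟨i, h⟩ else 0) * g i
          = ∑ i : s, d i * g i := by
        intro g
        rw [← Finset.sum_coe_sort s]
        exact Finset.sum_congr rfl fun i _ => by simp
      have key1 : ∑ i ∈ s, (if h : i ∈ s then d ⟨i, h⟩ else 0) = ∑ i : s, d i := by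
        simpa using key fun _ => 1
      rcases le_total 0 (∑ i : s, d i * b i) with hb | hb
      · refine ⟨fun i => if h : i ∈ s then d ⟨i, h⟩ else 0, ⟨i, i.2, by simpa using hi⟩, ?_, ?_, ?_⟩
        · rw [key1, hd'.1]
        · rw [key, hd'.2]
        · rw [key]; exact hb
      · refine ⟨fun i => -(if h : i ∈ s then d ⟨i, h⟩ else 0),
          ⟨i, i.2, by simpa using hi⟩, ?_, ?_, ?_⟩
        · rw [Finset.sum_neg_distrib, key1, hd'.1, neg_zero]
        · simp only [neg_mul]; rw [Finset.sum_neg_distrib, key, hd'.2, neg_zero]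
        · simp only [neg_mul]; rw [Finset.sum_neg_distrib, key]; linarith
    have hneg : (s.filter fun i => d i < 0).Nonempty := by
      by_contra hne
      rw [Finset.not_nonempty_iff_eq_empty, Finset.filter_eq_empty_iff] at hne
      push Not at hne
      obtain ⟨i, hi, hi0⟩ := hd0
      exact hi0 ((Finset.sum_eq_zero_iff_of_nonneg fun i hi => hne hi).1 hdsum i hi)
    -- The least ratio is the largest step that keeps all weights nonnegative; the weight at `k`
    -- becomes zero and that point is dropped.
    obtain ⟨k, hk, hmin⟩ := Finset.exists_min_image _ (fun i => w i / -d i) hneg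
    rw [Finset.mem_filter] at hk
    have hdk : 0 < -d k := by linarith [hk.2]
    set t := w k / -d k with ht
    have ht0 : 0 ≤ t := div_nonneg (hw k hk.1) hdk.le
    have hwk : w k + t * d k = 0 := by
      have := div_mul_cancel₀ (w k) hdk.ne'
      rw [← ht] at this
      linarith
    have hw' : ∀ i ∈ s, 0 ≤ w i + t * d i := by
      intro i hi
      rcases lt_or_ge (d i) 0 with h | h
      · have := hmin i (Finset.mem_filter.2 ⟨hi, h⟩)
        rw [le_div_iff₀ (by linarith)] at this
        linarith
      · have := hw i hi
        positivity
    have hers : ∀ g : ι → ℝ, ∑ i ∈ s.erase k, (w i + t * d i) * g i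
        = ∑ i ∈ s, w i * g i + t * ∑ i ∈ s, d i * g i := by
      intro g
      have := Finset.add_sum_erase s (fun i => (w i + t * d i) * g i) hk.1
      simp only [hwk, zero_mul, zero_add] at this
      rw [this, Finset.mul_sum, ← Finset.sum_add_distrib]
      exact Finset.sum_congr rfl fun i _ => by ring
    obtain ⟨i, hi, j, hj, α, h0, h1, hA, hB⟩ := ih (s.erase k).card
      (by rw [← hn]; exact Finset.card_erase_lt_of_mem hk.1) (s.erase k)
      (fun i => w i + t * d i) rfl (fun i hi => hw' i (Finset.mem_of_mem_erase hi))
      (by simpa [hdsum, hsum] using hers fun _ => 1)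
    rw [hers, hda] at hA
    rw [hers] at hB
    have := mul_nonneg ht0 hdb
    exact ⟨i, Finset.mem_of_mem_erase hi, j, Finset.mem_of_mem_erase hj, α, h0, h1,
      by linarith, by linarith⟩

/-- The points of the plane that are dominated by a mixture of two points of `S`. -/
def dominated (S : Set (ℝ × ℝ)) : Set (ℝ × ℝ) :=
  {z | ∃ u ∈ S, ∃ v ∈ S, ∃ α : ℝ, 0 ≤ α ∧ α ≤ 1 ∧
    z.1 ≤ α * u.1 + (1 - α) * v.1 ∧ z.2 ≤ α * u.2 + (1 - α) * v.2}

theorem dominated_mono_point {S : Set (ℝ × ℝ)} {z z' : ℝ × ℝ} (hz : z ∈ dominated S)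
    (h1 : z'.1 ≤ z.1) (h2 : z'.2 ≤ z.2) : z' ∈ dominated S := by
  obtain ⟨u, hu, v, hv, α, h⟩ := hz
  exact ⟨u, hu, v, hv, α, h.1, h.2.1, h1.trans h.2.2.1, h2.trans h.2.2.2⟩

theorem mean_mem_dominated {S : Set (ℝ × ℝ)} {ι : Type*} (s : Finset ι) (w : ι → ℝ)
    (z : ι → ℝ × ℝ) (hw : ∀ i ∈ s, 0 ≤ w i) (hsum : ∑ i ∈ s, w i = 1) (hz : ∀ i ∈ s, z i ∈ S) :
    (∑ i ∈ s, w i * (z i).1, ∑ i ∈ s, w i * (z i).2) ∈ dominated S := by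
  obtain ⟨i, hi, j, hj, α, h⟩ :=
    exists_pair_dominating_mean (fun i => (z i).1) (fun i => (z i).2) _ s w rfl hw hsum
  exact ⟨z i, hz i hi, z j, hz j hj, α, h⟩

theorem subset_dominated (S : Set (ℝ × ℝ)) : S ⊆ dominated S := fun z hz =>
  ⟨z, hz, z, hz, 1, by norm_num, le_rfl, by simp, by simp⟩

/-- Mixing two mixtures gives a mean of four points of `S`, which the planar reduction brings back
to two. -/
theorem convex_dominated (S : Set (ℝ × ℝ)) : Convex ℝ (dominated S) := by
  rintro z ⟨u, hu, v, hv, α, h0, h1, hz1, hz2⟩ z' ⟨u', hu', v', hv', α', h0', h1', hz1', hz2'⟩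
    a b ha hb hab
  have := mean_mem_dominated (S := S) Finset.univ
    (![a * α, a * (1 - α), b * α', b * (1 - α')] : Fin 4 → ℝ) ![u, v, u', v']
    (by
      intro i _
      fin_cases i <;> simp <;> apply mul_nonneg <;> linarith)
    (by simp [Fin.sum_univ_four]; linear_combination hab)
    (by
      intro i _
      fin_cases i <;> simpa)
  refine dominated_mono_point this ?_ ?_
  · simp only [Fin.sum_univ_four, Prod.fst_add, Prod.smul_fst, smul_eq_mul, Matrix.cons_val]
    nlinarith [mul_le_mul_of_nonneg_left hz1 ha, mul_le_mul_of_nonneg_left hz1' hb]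
  · simp only [Fin.sum_univ_four, Prod.snd_add, Prod.smul_snd, smul_eq_mul, Matrix.cons_val]
    nlinarith [mul_le_mul_of_nonneg_left hz2 ha, mul_le_mul_of_nonneg_left hz2' hb]

/-- The set is the compact set of two-point mixtures plus the closed negative quadrant. -/
theorem isClosed_dominated {S : Set (ℝ × ℝ)} (hS : IsCompact S) : IsClosed (dominated S) := by
  have hK : IsCompact ((fun q : (ℝ × ℝ) × (ℝ × ℝ) × ℝ => q.2.2 • q.1 + (1 - q.2.2) • q.2.1) ''
      (S ×ˢ S ×ˢ Set.Icc (0 : ℝ) 1)) :=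
    (hS.prod (hS.prod isCompact_Icc)).image (by fun_prop)
  have hC : IsClosed (Set.Iic (0 : ℝ × ℝ)) := isClosed_Iic
  convert hC.add_left_of_isCompact hK using 1
  ext z
  constructor
  · rintro ⟨u, hu, v, hv, α, h0, h1, hz1, hz2⟩
    refine ⟨α • u + (1 - α) • v, ⟨(u, v, α), ⟨hu, hv, h0, h1⟩, rfl⟩,
      z - (α • u + (1 - α) • v), ?_, by simp⟩
    rw [Set.mem_Iic, sub_nonpos]
    exact ⟨by simpa using hz1, by simpa using hz2⟩
  · rintro ⟨_, ⟨⟨u, v, α⟩, ⟨hu, hv, h0, h1⟩, rfl⟩, n, hn, rfl⟩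
    have h1' : n.1 ≤ 0 := hn.1
    have h2' : n.2 ≤ 0 := hn.2
    exact ⟨u, hu, v, hv, α, h0, h1, by simpa using h1', by simpa using h2'⟩

end Planar

/-! ### Divergence and mutual information. -/

/-- The tangent at `x = c * y` to the convex function `x * log (x / y)` of `x`. Being linear in `x`
and `y` it can be summed over any set of words; each use picks the slope through `c`. -/
theorem mul_log_div_ge {x y c : ℝ} (hx : 0 ≤ x) (hy : 0 < y) (hc : 0 < c) :
    x * Real.log c + x - c * y ≤ x * Real.log (x / y) := by
  rcases hx.eq_or_lt with rfl | hx
  · simp; positivity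
  have h := Real.one_sub_inv_le_log_of_pos (show 0 < x / (c * y) by positivity)
  have e : Real.log (x / (c * y)) = Real.log (x / y) - Real.log c := by
    rw [← Real.log_div (by positivity) hc.ne']; congr 1; field_simp
  rw [e] at h
  have := mul_le_mul_of_nonneg_left h hx.le
  have e2 : x * (1 - (x / (c * y))⁻¹) = x - c * y := by field_simp
  rw [e2] at this
  linarith

section Channel

variable {X Y : Type*} [Fintype X] [Fintype Y] (W : DMC X Y)

theorem kl_nonneg {p q : Y → ℝ} (hp : ∀ y, 0 ≤ p y) (hq : ∀ y, 0 < q y)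
    (h : ∑ y, q y ≤ ∑ y, p y) : 0 ≤ kl p q := by
  have : ∑ y, (p y - q y) ≤ kl p q := Finset.sum_le_sum fun y _ => by
    simpa using mul_log_div_ge (hp y) (hq y) one_pos
  rw [Finset.sum_sub_distrib] at this
  linarith

theorem DMC.out_pos {p : X → ℝ} (hp : p ∈ stdSimplex ℝ X) (y : Y) : 0 < W.out p y := by
  obtain ⟨x, -, hx⟩ : ∃ x ∈ Finset.univ, p x ≠ 0 :=
    Finset.exists_ne_zero_of_sum_ne_zero (by rw [hp.2]; norm_num)
  exact Finset.sum_pos' (fun x _ => mul_nonneg (hp.1 x) (W.pos x y).le)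
    ⟨x, Finset.mem_univ x, mul_pos (lt_of_le_of_ne (hp.1 x) hx.symm) (W.pos x y)⟩

theorem DMC.sum_mul_prob (p : X → ℝ) : ∑ y, W.out p y = ∑ x, p x := by
  simp only [DMC.out]
  rw [Finset.sum_comm]
  simp [← Finset.mul_sum, W.sum_eq_one]

theorem DMC.kl_prob_le (x x' : X) : kl (W.prob x) (W.prob x') ≤ W.maxDiv :=
  le_ciSup (f := fun q : X × X => kl (W.prob q.1) (W.prob q.2)) (Set.finite_range _).bddAbove (x, x')

theorem DMC.mutualInfo_eq (p : X → ℝ) :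
    W.mutualInfo p = ∑ x, p x * kl (W.prob x) (W.out p) := by
  simp only [DMC.mutualInfo, kl, Finset.mul_sum, mul_assoc]

theorem DMC.kl_prob_out_nonneg {p : X → ℝ} (hp : p ∈ stdSimplex ℝ X) (x : X) :
    0 ≤ kl (W.prob x) (W.out p) :=
  kl_nonneg (fun y => (W.pos x y).le) (W.out_pos hp)
    (by rw [W.sum_mul_prob, hp.2, W.sum_eq_one])

theorem DMC.mutualInfo_nonneg {p : X → ℝ} (hp : p ∈ stdSimplex ℝ X) : 0 ≤ W.mutualInfo p := by
  rw [W.mutualInfo_eq]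
  exact Finset.sum_nonneg fun x _ => mul_nonneg (hp.1 x) (W.kl_prob_out_nonneg hp x)

/-- The compensation identity: the mean divergence of the rows from `W_x` splits into the mutual
information and the divergence of the output law. -/
theorem DMC.kl_out_eq {p : X → ℝ} (hp : p ∈ stdSimplex ℝ X) (x : X) :
    kl (W.out p) (W.prob x) = ∑ x', p x' * kl (W.prob x') (W.prob x) - W.mutualInfo p := by
  have e : ∀ y, W.out p y * Real.log (W.out p y / W.prob x y) =
      ∑ x', p x' * (W.prob x' y * Real.log (W.prob x' y / W.prob x y)) -
      ∑ x', p x' * W.prob x' y * Real.log (W.prob x' y / W.out p y) := by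
    intro y
    rw [← Finset.sum_sub_distrib]
    nth_rewrite 1 [DMC.out]
    rw [Finset.sum_mul]
    refine Finset.sum_congr rfl fun x' _ => ?_
    rw [Real.log_div (W.out_pos hp y).ne' (W.pos x y).ne',
      Real.log_div (W.pos x' y).ne' (W.pos x y).ne', Real.log_div (W.pos x' y).ne'
      (W.out_pos hp y).ne']
    ring
  simp only [kl, e, Finset.sum_sub_distrib, DMC.mutualInfo, Finset.mul_sum]
  rw [Finset.sum_comm (s := Finset.univ (α := Y)), Finset.sum_comm (s := Finset.univ (α := Y))]

theorem DMC.kl_out_nonneg {p : X → ℝ} (hp : p ∈ stdSimplex ℝ X) (x : X) :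
    0 ≤ kl (W.out p) (W.prob x) :=
  kl_nonneg (fun y => (W.out_pos hp y).le) (W.pos x)
    (by rw [W.sum_mul_prob, hp.2, W.sum_eq_one])

theorem DMC.kl_out_add_mutualInfo_le {p : X → ℝ} (hp : p ∈ stdSimplex ℝ X) (x : X) :
    kl (W.out p) (W.prob x) + W.mutualInfo p ≤ W.maxDiv := by
  rw [W.kl_out_eq hp, sub_add_cancel]
  calc _ ≤ ∑ x', p x' * W.maxDiv :=
        Finset.sum_le_sum fun x' _ => mul_le_mul_of_nonneg_left (W.kl_prob_le _ _) (hp.1 x')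
    _ = W.maxDiv := by rw [← Finset.sum_mul, hp.2, one_mul]

theorem DMC.kl_out_le {p : X → ℝ} (hp : p ∈ stdSimplex ℝ X) (x : X) :
    kl (W.out p) (W.prob x) ≤ W.maxDiv := by
  linarith [W.kl_out_add_mutualInfo_le hp x, W.mutualInfo_nonneg hp]

theorem DMC.mutualInfo_le [Nonempty X] {p : X → ℝ} (hp : p ∈ stdSimplex ℝ X) :
    W.mutualInfo p ≤ W.maxDiv := by
  obtain ⟨x⟩ := ‹Nonempty X›
  linarith [W.kl_out_add_mutualInfo_le hp x, W.kl_out_nonneg hp x]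

theorem DMC.maxDiv_nonneg [Nonempty X] : 0 ≤ W.maxDiv := by
  obtain ⟨x⟩ := ‹Nonempty X›
  exact (kl_nonneg (fun y => (W.pos x y).le) (W.pos x) le_rfl).trans (W.kl_prob_le x x)

/-- Divergence is convex in its second argument; here this is Jensen's inequality for `log`, proved
through `log u ≤ u - 1`. -/
theorem DMC.kl_prob_out_le {p : X → ℝ} (hp : p ∈ stdSimplex ℝ X) (x : X) :
    kl (W.prob x) (W.out p) ≤ W.maxDiv := by
  have h1 : kl (W.prob x) (W.out p) ≤ ∑ x', p x' * kl (W.prob x) (W.prob x') := by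
    simp only [kl, Finset.mul_sum]
    rw [Finset.sum_comm]
    refine Finset.sum_le_sum fun y _ => ?_
    have ho := W.out_pos hp y
    have h2 : ∑ x', p x' * Real.log (W.prob x' y / W.out p y) ≤ 0 := by
      calc _ ≤ ∑ x', p x' * (W.prob x' y / W.out p y - 1) :=
            Finset.sum_le_sum fun x' _ => mul_le_mul_of_nonneg_left
              (Real.log_le_sub_one_of_pos (div_pos (W.pos x' y) ho)) (hp.1 x')
        _ = (∑ x', p x' * W.prob x' y) / W.out p y - ∑ x', p x' := by
            rw [Finset.sum_div, ← Finset.sum_sub_distrib]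
            exact Finset.sum_congr rfl fun _ _ => by ring
        _ = 0 := by
            rw [hp.2]
            change W.out p y / W.out p y - 1 = 0
            rw [div_self ho.ne', sub_self]
    have h3 : ∑ x', p x' * (W.prob x y * Real.log (W.prob x y / W.prob x' y)) =
        W.prob x y * (Real.log (W.prob x y / W.out p y) -
          ∑ x', p x' * Real.log (W.prob x' y / W.out p y)) := by
      have : Real.log (W.prob x y / W.out p y) =
          ∑ x', p x' * Real.log (W.prob x y / W.out p y) := by
        rw [← Finset.sum_mul, hp.2, one_mul]
      rw [this, ← Finset.sum_sub_distrib, Finset.mul_sum]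
      refine Finset.sum_congr rfl fun x' _ => ?_
      rw [Real.log_div (W.pos x y).ne' ho.ne', Real.log_div (W.pos x y).ne' (W.pos x' y).ne',
        Real.log_div (W.pos x' y).ne' ho.ne']
      ring
    rw [h3]
    exact mul_le_mul_of_nonneg_left (by linarith) (W.pos x y).le
  refine h1.trans ?_
  calc _ ≤ ∑ x', p x' * W.maxDiv :=
        Finset.sum_le_sum fun x' _ => mul_le_mul_of_nonneg_left (W.kl_prob_le _ _) (hp.1 x')
    _ = W.maxDiv := by rw [← Finset.sum_mul, hp.2, one_mul]

theorem DMC.prob_le_one (x : X) (y : Y) : W.prob x y ≤ 1 := by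
  rw [← W.sum_eq_one x]
  exact Finset.single_le_sum (f := W.prob x) (fun y _ => (W.pos x y).le) (Finset.mem_univ y)

theorem DMC.minProb_le (x : X) (y : Y) : W.minProb ≤ W.prob x y :=
  ciInf_le (f := fun q : X × Y => W.prob q.1 q.2) (Set.finite_range _).bddBelow (x, y)

theorem DMC.minProb_pos [Nonempty X] [Nonempty Y] : 0 < W.minProb := by
  obtain ⟨q, hq⟩ := exists_eq_ciInf_of_finite (f := fun q : X × Y => W.prob q.1 q.2)
  rw [DMC.minProb, ← hq]
  exact W.pos _ _

/-- The pairs of a mutual information and an output divergence that `J` mixes. -/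
def DMC.infoDivSet : Set (ℝ × ℝ) :=
  {z | ∃ p ∈ stdSimplex ℝ X, ∃ x, z = (W.mutualInfo p, kl (W.out p) (W.prob x))}

theorem DMC.isCompact_infoDivSet : IsCompact W.infoDivSet := by
  have hout : Continuous fun p : X → ℝ => W.out p := by
    unfold DMC.out; fun_prop
  have hI : ContinuousOn W.mutualInfo (stdSimplex ℝ X) := by
    unfold DMC.mutualInfo
    refine continuousOn_finsetSum _ fun x _ => continuousOn_finsetSum _ fun y _ => ?_
    refine ContinuousOn.mul (by fun_prop) (ContinuousOn.log ?_ fun p hp =>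
      (div_pos (W.pos x y) (W.out_pos hp y)).ne')
    exact continuousOn_const.div ((continuous_apply y).comp hout).continuousOn
      fun p hp => (W.out_pos hp y).ne'
  have hk : ∀ x, ContinuousOn (fun p => kl (W.out p) (W.prob x)) (stdSimplex ℝ X) := by
    intro x
    unfold kl
    refine continuousOn_finsetSum _ fun y _ => ?_
    have hy : Continuous fun p => W.out p y := (continuous_apply y).comp hout
    refine ContinuousOn.mul hy.continuousOn (ContinuousOn.log ?_ fun p hp =>
      (div_pos (W.out_pos hp y) (W.pos x y)).ne')
    exact (hy.div_const _).continuousOn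
  have : W.infoDivSet =
      ⋃ x, (fun p => (W.mutualInfo p, kl (W.out p) (W.prob x))) '' stdSimplex ℝ X := by
    ext z
    simp only [DMC.infoDivSet, Set.mem_ofPred_eq, Set.mem_iUnion, Set.mem_image]
    constructor
    · rintro ⟨p, hp, x, rfl⟩; exact ⟨x, p, hp, rfl⟩
    · rintro ⟨x, p, hp, rfl⟩; exact ⟨p, hp, x, rfl⟩
  rw [this]
  exact isCompact_iUnion fun x => (isCompact_stdSimplex ℝ X).image_of_continuousOn (hI.prodMk (hk x))

/-- Boundedness of the set has to be checked, since `sSup` of an unbounded set of reals is the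
default value 0. -/
theorem DMC.le_J {R v : ℝ} (h : (R, v) ∈ dominated W.infoDivSet) : v ≤ W.J R := by
  obtain ⟨_, ⟨p₁, hp₁, x₁, rfl⟩, _, ⟨p₂, hp₂, x₂, rfl⟩, α, h0, h1, hR, hv⟩ := h
  refine hv.trans (le_csSup ⟨W.maxDiv, ?_⟩ ⟨α, x₁, x₂, p₁, p₂, h0, h1, hp₁, hp₂, hR, rfl⟩)
  rintro _ ⟨α, x₁, x₂, p₁, p₂, h0, h1, hp₁, hp₂, -, rfl⟩
  nlinarith [mul_le_mul_of_nonneg_left (W.kl_out_le hp₁ x₁) h0,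
    mul_le_mul_of_nonneg_left (W.kl_out_le hp₂ x₂) (sub_nonneg.2 h1)]

theorem DMC.mutualInfo_le_capacity [Nonempty X] {p : X → ℝ} (hp : p ∈ stdSimplex ℝ X) :
    W.mutualInfo p ≤ W.capacity := by
  refine le_csSup ⟨W.maxDiv, ?_⟩ ⟨p, hp, rfl⟩
  rintro _ ⟨p, hp, rfl⟩
  exact W.mutualInfo_le hp

theorem DMC.le_capacity [Nonempty X] {z : ℝ × ℝ} (h : z ∈ dominated W.infoDivSet) :
    z.1 ≤ W.capacity := by
  obtain ⟨_, ⟨p₁, hp₁, x₁, rfl⟩, _, ⟨p₂, hp₂, x₂, rfl⟩, α, h0, h1, hR, hv⟩ := h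
  nlinarith [mul_le_mul_of_nonneg_left (W.mutualInfo_le_capacity hp₁) h0,
    mul_le_mul_of_nonneg_left (W.mutualInfo_le_capacity hp₂) (sub_nonneg.2 h1)]

/-- A point mass at a letter whose row is farthest from some other row attains divergence `D`; its
mutual information only needs to be nonnegative. -/
theorem DMC.zero_maxDiv_mem [Nonempty X] : (0, W.maxDiv) ∈ dominated W.infoDivSet := by
  classical
  obtain ⟨⟨x, x'⟩, hx⟩ :=
    exists_eq_ciSup_of_finite (f := fun q : X × X => kl (W.prob q.1) (W.prob q.2))
  have hp := single_mem_stdSimplex ℝ x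
  have ho : W.out (Pi.single x 1) = W.prob x := by
    ext y
    simp [DMC.out, Pi.single_apply]
  refine dominated_mono_point (subset_dominated _ ⟨_, hp, x', rfl⟩) (W.mutualInfo_nonneg hp) ?_
  rw [ho]
  exact hx.ge

end Channel

open Filter Topology

/-! ### Optional stopping on finite trees of words. -/

section Tree

variable {Y : Type*}

/-- The word `w` followed by the letter `y`. -/
def wsnoc {t : ℕ} (w : Fin t → Y) (y : Y) : Fin (t + 1) → Y := Fin.snoc (α := fun _ => Y) w y

@[simp] theorem wsnoc_castSucc {t : ℕ} (w : Fin t → Y) (y : Y) (i : Fin t) :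
    wsnoc w y i.castSucc = w i := by simp [wsnoc]

@[simp] theorem wsnoc_last {t : ℕ} (w : Fin t → Y) (y : Y) :
    wsnoc w y (Fin.last t) = y := by simp [wsnoc]

theorem forall_fin_wsnoc {t : ℕ} (z : ℕ → Y) (w : Fin t → Y) (y : Y) :
    (∀ i : Fin (t + 1), z i = wsnoc w y i) ↔ (∀ i : Fin t, z i = w i) ∧ z t = y := by
  rw [Fin.forall_fin_succ']
  simp

variable [Fintype Y]

theorem sum_words_succ {t : ℕ} (f : (Fin (t + 1) → Y) → ℝ) :
    ∑ w, f w = ∑ w : Fin t → Y, ∑ y, f (wsnoc w y) := by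
  rw [← (Fin.snocEquiv fun _ : Fin (t + 1) => Y).sum_comp, Fintype.sum_prod_type_right]
  rfl

variable (B : (t : ℕ) → (Fin t → Y) → Prop)

/-- A set of words that contains the empty word and is closed under taking initial segments. -/
structure IsTree : Prop where
  root : ∀ w : Fin 0 → Y, B 0 w
  init : ∀ (t : ℕ) (w : Fin t → Y) (y : Y), B (t + 1) (wsnoc w y) → B t w

open scoped Classical in
/-- The sum of `φ` over the words of length `t` of the tree. -/
def treeSum (φ : (t : ℕ) → (Fin t → Y) → ℝ) (t : ℕ) : ℝ :=
  ∑ w : Fin t → Y, if B t w then φ t w else 0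

open scoped Classical in
/-- The sum of `φ` over the words of length `t + 1` at which the tree is left. -/
def exitSum (φ : (t : ℕ) → (Fin t → Y) → ℝ) (t : ℕ) : ℝ :=
  ∑ w : Fin t → Y, ∑ y, if B t w ∧ ¬B (t + 1) (wsnoc w y) then φ (t + 1) (wsnoc w y) else 0

/-- The sum of `φ` over the exits of length at most `n` and the words of length `n` in the tree. -/
def leafSum (φ : (t : ℕ) → (Fin t → Y) → ℝ) (n : ℕ) : ℝ :=
  treeSum B φ n + ∑ t ∈ Finset.range n, exitSum B φ t

/-- The drift of `φ` in one step. -/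
def drift (φ : (t : ℕ) → (Fin t → Y) → ℝ) (t : ℕ) (w : Fin t → Y) : ℝ :=
  ∑ y, φ (t + 1) (wsnoc w y) - φ t w

variable {B}

/-- Lengthening the tree by one level replaces each inner word by its one-letter extensions, and the
change is the drift there. No integrability is needed because everything is finite. -/
theorem leafSum_eq (hB : IsTree B) (φ : (t : ℕ) → (Fin t → Y) → ℝ) (n : ℕ) :
    leafSum B φ n = φ 0 Fin.elim0 + ∑ t ∈ Finset.range n, treeSum B (drift φ) t := by
  classical
  induction n with
  | zero =>
    simp only [leafSum, treeSum, Finset.range_zero, Finset.sum_empty, add_zero, hB.root, if_true]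
    rw [Fintype.sum_unique]
    congr 1
  | succ n ih =>
    have key : treeSum B φ (n + 1) + exitSum B φ n = treeSum B φ n + treeSum B (drift φ) n := by
      simp only [treeSum, exitSum, sum_words_succ]
      rw [← Finset.sum_add_distrib, ← Finset.sum_add_distrib]
      refine Finset.sum_congr rfl fun w _ => ?_
      rw [← Finset.sum_add_distrib]
      by_cases hw : B n w
      · simp only [hw, true_and, if_true, drift, add_sub_cancel]
        refine Finset.sum_congr rfl fun y _ => ?_
        by_cases hy : B (n + 1) (wsnoc w y) <;> simp [hy]
      · have : ∀ y, ¬B (n + 1) (wsnoc w y) := fun y h => hw (hB.init n w y h)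
        simp [hw, this]
    rw [Finset.sum_range_succ, ← add_assoc, ← ih, leafSum, leafSum, Finset.sum_range_succ]
    linarith

theorem treeSum_mono {φ ψ : (t : ℕ) → (Fin t → Y) → ℝ} {t : ℕ}
    (h : ∀ w : Fin t → Y, B t w → φ t w ≤ ψ t w) : treeSum B φ t ≤ treeSum B ψ t := by
  refine Finset.sum_le_sum fun w _ => ?_
  split_ifs with hw
  exacts [h w hw, le_rfl]

theorem exitSum_mono {φ ψ : (t : ℕ) → (Fin t → Y) → ℝ} {t : ℕ}
    (h : ∀ (w : Fin t → Y) (y : Y), B t w → ¬B (t + 1) (wsnoc w y) →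
      φ (t + 1) (wsnoc w y) ≤ ψ (t + 1) (wsnoc w y)) : exitSum B φ t ≤ exitSum B ψ t := by
  refine Finset.sum_le_sum fun w _ => Finset.sum_le_sum fun y _ => ?_
  split_ifs with hw
  exacts [h w y hw.1 hw.2, le_rfl]

theorem treeSum_nonneg {φ : (t : ℕ) → (Fin t → Y) → ℝ} {t : ℕ}
    (h : ∀ w : Fin t → Y, B t w → 0 ≤ φ t w) : 0 ≤ treeSum B φ t := by
  refine Finset.sum_nonneg fun w _ => ?_
  split_ifs with hw
  exacts [h w hw, le_rfl]

theorem exitSum_nonneg {φ : (t : ℕ) → (Fin t → Y) → ℝ} {t : ℕ}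
    (h : ∀ w : Fin (t + 1) → Y, 0 ≤ φ (t + 1) w) : 0 ≤ exitSum B φ t := by
  refine Finset.sum_nonneg fun w _ => Finset.sum_nonneg fun y _ => ?_
  split_ifs with hw
  exacts [h _, le_rfl]

theorem treeSum_add (φ ψ : (t : ℕ) → (Fin t → Y) → ℝ) (t : ℕ) :
    treeSum B (fun t w => φ t w + ψ t w) t = treeSum B φ t + treeSum B ψ t := by
  simp only [treeSum]
  rw [← Finset.sum_add_distrib]
  exact Finset.sum_congr rfl fun w _ => by split_ifs <;> simp

theorem exitSum_add (φ ψ : (t : ℕ) → (Fin t → Y) → ℝ) (t : ℕ) :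
    exitSum B (fun t w => φ t w + ψ t w) t = exitSum B φ t + exitSum B ψ t := by
  simp only [exitSum]
  rw [← Finset.sum_add_distrib]
  refine Finset.sum_congr rfl fun w _ => ?_
  rw [← Finset.sum_add_distrib]
  exact Finset.sum_congr rfl fun w _ => by split_ifs <;> simp

theorem treeSum_mul (a : ℝ) (φ : (t : ℕ) → (Fin t → Y) → ℝ) (t : ℕ) :
    treeSum B (fun t w => a * φ t w) t = a * treeSum B φ t := by
  simp only [treeSum, Finset.mul_sum]
  exact Finset.sum_congr rfl fun w _ => by split_ifs <;> simp

theorem exitSum_mul (a : ℝ) (φ : (t : ℕ) → (Fin t → Y) → ℝ) (t : ℕ) :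
    exitSum B (fun t w => a * φ t w) t = a * exitSum B φ t := by
  simp only [exitSum, Finset.mul_sum]
  exact Finset.sum_congr rfl fun w _ => Finset.sum_congr rfl fun y _ => by split_ifs <;> simp

theorem leafSum_mono {φ ψ : (t : ℕ) → (Fin t → Y) → ℝ} {n : ℕ}
    (h1 : ∀ w, B n w → φ n w ≤ ψ n w)
    (h2 : ∀ (t : ℕ) (w : Fin t → Y) (y : Y), B t w → ¬B (t + 1) (wsnoc w y) →
      φ (t + 1) (wsnoc w y) ≤ ψ (t + 1) (wsnoc w y)) : leafSum B φ n ≤ leafSum B ψ n :=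
  add_le_add (treeSum_mono h1) (Finset.sum_le_sum fun t _ => exitSum_mono (h2 t))

theorem leafSum_add (φ ψ : (t : ℕ) → (Fin t → Y) → ℝ) (n : ℕ) :
    leafSum B (fun t w => φ t w + ψ t w) n = leafSum B φ n + leafSum B ψ n := by
  simp only [leafSum, treeSum_add, exitSum_add, Finset.sum_add_distrib]
  ring

theorem leafSum_mul (a : ℝ) (φ : (t : ℕ) → (Fin t → Y) → ℝ) (n : ℕ) :
    leafSum B (fun t w => a * φ t w) n = a * leafSum B φ n := by
  simp only [leafSum, treeSum_mul, exitSum_mul, ← Finset.mul_sum, mul_add]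

theorem leafSum_le (hB : IsTree B) {φ b : (t : ℕ) → (Fin t → Y) → ℝ}
    (h : ∀ t w, B t w → drift φ t w ≤ b t w) (n : ℕ) :
    leafSum B φ n ≤ φ 0 Fin.elim0 + ∑ t ∈ Finset.range n, treeSum B b t := by
  rw [leafSum_eq hB]
  gcongr with t _
  exact treeSum_mono (h t)

end Tree

/-! ### The tree of words at which a Markov time has not been reached. -/

section MarkovTime

variable {Y : Type*}

/-- The Markov time is not yet reached at the end of the word `w`. -/
def MarkovTime.Alive (τ : MarkovTime Y) (t : ℕ) (w : Fin t → Y) : Prop :=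
  ∀ y : ℕ → Y, (∀ i : Fin t, y i = w i) → (t : ℕ∞) < τ.time y

theorem exists_extension [Nonempty Y] {t : ℕ} (w : Fin t → Y) : ∃ y : ℕ → Y, ∀ i : Fin t, y i = w i := by
  obtain ⟨y₀⟩ := ‹Nonempty Y›
  exact ⟨fun i => if h : i < t then w ⟨i, h⟩ else y₀, fun i => by simp⟩

/-- This turns sums over stopping words into sums over exits of the tree `Alive`. -/
theorem MarkovTime.stopsAt_wsnoc_iff [Nonempty Y] (τ : MarkovTime Y) {t : ℕ} (w : Fin t → Y) (y : Y) :
    τ.StopsAt (t + 1) (wsnoc w y) ↔ τ.Alive t w ∧ ¬τ.Alive (t + 1) (wsnoc w y) := by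
  constructor
  · intro h
    refine ⟨fun z hz => ?_, fun h' => ?_⟩
    · by_contra hlt
      push Not at hlt
      obtain ⟨s, hs⟩ := ENat.ne_top_iff_exists.1 (ne_top_of_le_ne_top (ENat.natCast_ne_top t) hlt)
      rw [← hs, Nat.cast_le] at hlt
      -- If the time were at most `t` on `z`, it would be the same on any sequence that agrees with
      -- `z` up to `t`, in particular on one continuing with `y`.
      let z' : ℕ → Y := fun i => if i < t then z i else y
      have h1 : τ.time z' = s := τ.markov s z z' (fun i hi => by simp [z', hi.trans_le hlt]) hs.symm
      have h2 : τ.time z' = (t + 1 : ℕ) := h z' ((forall_fin_wsnoc _ _ _).2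
        ⟨fun i => by simp [z', hz], by simp [z']⟩)
      rw [h1, Nat.cast_inj] at h2
      omega
    · obtain ⟨z, hz⟩ := exists_extension (wsnoc w y)
      have := h' z hz
      rw [h z hz] at this
      exact lt_irrefl _ this
  · rintro ⟨h, h'⟩ z hz
    simp only [MarkovTime.Alive] at h'
    push Not at h'
    obtain ⟨z', hz', hle⟩ := h'
    have hlt := h z' ((forall_fin_wsnoc _ _ _).1 hz').1
    have heq : τ.time z' = (t + 1 : ℕ) := by
      refine le_antisymm hle ?_
      rw [Nat.cast_add, Nat.cast_one]
      exact Order.add_one_le_of_lt hlt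
    refine τ.markov _ z' z (fun i hi => ?_) heq
    rw [hz' ⟨i, hi⟩, hz ⟨i, hi⟩]

theorem MarkovTime.not_stopsAt_zero [Nonempty Y] (τ : MarkovTime Y) (w : Fin 0 → Y) : ¬τ.StopsAt 0 w := by
  intro h
  obtain ⟨z, hz⟩ := exists_extension w
  have := τ.one_le z
  rw [h z hz] at this
  simp at this

theorem MarkovTime.isTree_alive (τ : MarkovTime Y) : IsTree τ.Alive where
  root w z _ := by
    have := τ.one_le z
    exact lt_of_lt_of_le (by simp) this
  init t w y h z hz := by
    by_contra hlt
    push Not at hlt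
    obtain ⟨s, hs⟩ := ENat.ne_top_iff_exists.1 (ne_top_of_le_ne_top (ENat.natCast_ne_top t) hlt)
    rw [← hs, Nat.cast_le] at hlt
    let z' : ℕ → Y := fun i => if i < t then z i else y
    have h1 : τ.time z' = s := τ.markov s z z' (fun i hi => by simp [z', hi.trans_le hlt]) hs.symm
    have h2 := h z' ((forall_fin_wsnoc _ _ _).2 ⟨fun i => by simp [z', hz], by simp [z']⟩)
    rw [h1, Nat.cast_lt] at h2
    omega

end MarkovTime

variable {X Y M : Type*} [Fintype X] [Fintype Y] [Fintype M]

theorem DMC.wordProb_wsnoc (W : DMC X Y) (f : (t : ℕ) → (Fin t → Y) → X) (t : ℕ) (w : Fin t → Y)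
    (y : Y) : W.wordProb f (t + 1) (wsnoc w y) = W.wordProb f t w * W.prob (f t w) y := by
  unfold DMC.wordProb
  rw [Fin.prod_univ_castSucc]
  congr 1
  · refine Finset.prod_congr rfl fun i _ => ?_
    rw [wsnoc_castSucc]
    congr 2
    ext j
    exact wsnoc_castSucc w y (Fin.castLE i.is_lt.le j)
  · rw [wsnoc_last]
    congr 2
    ext j
    exact wsnoc_castSucc w y j

theorem DMC.wordProb_pos (W : DMC X Y) (f : (t : ℕ) → (Fin t → Y) → X) (t : ℕ) (w : Fin t → Y) :
    0 < W.wordProb f t w := Finset.prod_pos fun _ _ => W.pos _ _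

/-! ### Word probabilities of a code and the decoding time. -/

namespace VLCode

variable {W : DMC X Y}

/-- Without messages the total mass would be 0, against `finite_time`; inputs and outputs then exist
as well. -/
theorem nonempty_message (c : VLCode W M) : Nonempty M := by
  by_contra h
  rw [not_nonempty_iff] at h
  have := c.finite_time
  simp only [Finset.univ_eq_empty, Finset.sum_empty, Finset.sum_const_zero] at this
  exact zero_ne_one (hasSum_zero.unique this)

theorem nonempty_input (c : VLCode W M) : Nonempty X := by
  obtain ⟨m⟩ := c.nonempty_message
  exact ⟨c.enc m 0 Fin.elim0⟩

theorem nonempty_output (c : VLCode W M) : Nonempty Y := by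
  obtain ⟨x⟩ := c.nonempty_input
  by_contra h
  rw [not_nonempty_iff] at h
  have := W.sum_eq_one x
  simp at this

theorem card_pos (c : VLCode W M) : 0 < (Fintype.card M : ℝ) := by
  have := c.nonempty_message
  exact_mod_cast Fintype.card_pos

variable (c : VLCode W M)

/-- The probability of the message `m` and the output word `w`, regardless of the decoding time. -/
def msgProb (m : M) (t : ℕ) (w : Fin t → Y) : ℝ :=
  (Fintype.card M : ℝ)⁻¹ * W.wordProb (c.enc m) t w

/-- The probability of the output word `w`, regardless of the decoding time. -/
def outProb (t : ℕ) (w : Fin t → Y) : ℝ := ∑ m, c.msgProb m t w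

theorem msgProb_wsnoc (m : M) (t : ℕ) (w : Fin t → Y) (y : Y) :
    c.msgProb m (t + 1) (wsnoc w y) = c.msgProb m t w * W.prob (c.enc m t w) y := by
  rw [msgProb, W.wordProb_wsnoc, msgProb, mul_assoc]

theorem msgProb_zero (m : M) (w : Fin 0 → Y) : c.msgProb m 0 w = (Fintype.card M : ℝ)⁻¹ := by
  simp [msgProb, DMC.wordProb]

theorem msgProb_pos (m : M) (t : ℕ) (w : Fin t → Y) : 0 < c.msgProb m t w :=
  mul_pos (inv_pos.2 c.card_pos) (W.wordProb_pos _ _ _)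

theorem outProb_pos (t : ℕ) (w : Fin t → Y) : 0 < c.outProb t w := by
  have := c.nonempty_message
  exact Finset.sum_pos (fun m _ => c.msgProb_pos m t w) Finset.univ_nonempty

theorem outProb_zero (w : Fin 0 → Y) : c.outProb 0 w = 1 := by
  simp only [outProb, msgProb_zero, Finset.sum_const, Finset.card_univ, nsmul_eq_mul]
  exact mul_inv_cancel₀ c.card_pos.ne'

theorem msgProb_le_outProb (m : M) (t : ℕ) (w : Fin t → Y) : c.msgProb m t w ≤ c.outProb t w :=
  Finset.single_le_sum (f := fun m => c.msgProb m t w) (fun m _ => (c.msgProb_pos m t w).le)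
    (Finset.mem_univ m)

theorem sum_msgProb_wsnoc (m : M) (t : ℕ) (w : Fin t → Y) :
    ∑ y, c.msgProb m (t + 1) (wsnoc w y) = c.msgProb m t w := by
  simp only [msgProb_wsnoc, ← Finset.mul_sum, W.sum_eq_one, mul_one]

theorem sum_outProb_wsnoc (t : ℕ) (w : Fin t → Y) :
    ∑ y, c.outProb (t + 1) (wsnoc w y) = c.outProb t w := by
  simp only [outProb]
  rw [Finset.sum_comm]
  simp only [sum_msgProb_wsnoc]

theorem isTree_alive : IsTree c.τ.Alive := c.τ.isTree_alive

open scoped Classical in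
theorem sum_jointProb_succ (S : M → (t : ℕ) → (Fin t → Y) → Prop) (t : ℕ) :
    ∑ w : Fin (t + 1) → Y, ∑ m,
      (if S m (t + 1) w then W.jointProb c.τ c.enc m (t + 1) w else 0) =
    exitSum c.τ.Alive (fun t w => ∑ m, if S m t w then c.msgProb m t w else 0) t := by
  have := c.nonempty_output
  rw [sum_words_succ, exitSum]
  refine Finset.sum_congr rfl fun w _ => Finset.sum_congr rfl fun y _ => ?_
  simp only [DMC.jointProb, c.τ.stopsAt_wsnoc_iff]
  split_ifs with h
  · rfl
  · simp

open scoped Classical in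
theorem summable_Pr (S : M → (t : ℕ) → (Fin t → Y) → Prop) :
    Summable fun t : ℕ => ∑ w : Fin t → Y, ∑ m,
      if S m t w then W.jointProb c.τ c.enc m t w else 0 := by
  have h0 : ∀ m t w, 0 ≤ W.jointProb c.τ c.enc m t w := by
    intro m t w
    rw [DMC.jointProb]
    split_ifs
    exacts [(c.msgProb_pos m t w).le, le_rfl]
  refine Summable.of_nonneg_of_le (fun t => Finset.sum_nonneg fun w _ =>
    Finset.sum_nonneg fun m _ => ?_) (fun t => Finset.sum_le_sum fun w _ =>
    Finset.sum_le_sum fun m _ => ?_) c.finite_time.summable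
  · split_ifs
    exacts [h0 _ _ _, le_rfl]
  · split_ifs
    exacts [le_rfl, h0 _ _ _]

open scoped Classical in
theorem tendsto_Pr (S : M → (t : ℕ) → (Fin t → Y) → Prop) :
    Tendsto (fun n => ∑ t ∈ Finset.range n,
      exitSum c.τ.Alive (fun t w => ∑ m, if S m t w then c.msgProb m t w else 0) t)
      atTop (𝓝 (c.Pr S)) := by
  have := c.nonempty_output
  have h := (c.summable_Pr S).hasSum.tendsto_sum_nat
  -- An exit with index `t` has length `t + 1`, and the empty word contributes nothing because the
  -- Markov time is at least 1.
  rw [← tendsto_add_atTop_iff_nat 1] at h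
  refine h.congr fun n => ?_
  rw [Finset.sum_range_succ']
  simp only [sum_jointProb_succ]
  simp [DMC.jointProb, c.τ.not_stopsAt_zero]

open scoped Classical in
theorem sum_exit_le_Pr (S : M → (t : ℕ) → (Fin t → Y) → Prop) (n : ℕ) :
    ∑ t ∈ Finset.range n,
      exitSum c.τ.Alive (fun t w => ∑ m, if S m t w then c.msgProb m t w else 0) t ≤ c.Pr S := by
  refine Monotone.ge_of_tendsto (monotone_nat_of_le_succ fun k => ?_) (c.tendsto_Pr S) n
  rw [Finset.sum_range_succ]
  refine le_add_of_nonneg_right (exitSum_nonneg fun w => Finset.sum_nonneg fun m _ => ?_)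
  split_ifs
  exacts [(c.msgProb_pos _ _ _).le, le_rfl]

/-- The probability that the decoding time exceeds `n`. -/
def aliveProb (n : ℕ) : ℝ := treeSum c.τ.Alive c.outProb n

theorem aliveProb_nonneg (n : ℕ) : 0 ≤ c.aliveProb n :=
  treeSum_nonneg fun w _ => (c.outProb_pos n w).le

theorem drift_outProb (t : ℕ) (w : Fin t → Y) : drift c.outProb t w = 0 := by
  rw [drift, sum_outProb_wsnoc, sub_self]

theorem leafSum_outProb {B : (t : ℕ) → (Fin t → Y) → Prop} (hB : IsTree B) (n : ℕ) :
    leafSum B c.outProb n = 1 := by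
  rw [leafSum_eq hB, outProb_zero]
  simp [treeSum, drift_outProb]

theorem drift_msgProb (m : M) (t : ℕ) (w : Fin t → Y) : drift (c.msgProb m) t w = 0 := by
  rw [drift, sum_msgProb_wsnoc, sub_self]

theorem leafSum_msgProb {B : (t : ℕ) → (Fin t → Y) → Prop} (hB : IsTree B) (m : M) (n : ℕ) :
    leafSum B (c.msgProb m) n = (Fintype.card M : ℝ)⁻¹ := by
  rw [leafSum_eq hB, msgProb_zero]
  simp [treeSum, drift_msgProb]

theorem Pr_true : c.Pr (fun _ _ _ => True) = 1 := by
  rw [Pr]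
  simpa using c.finite_time.tsum_eq

theorem tendsto_sum_exit_outProb : Tendsto (fun n => ∑ t ∈ Finset.range n,
    exitSum c.τ.Alive c.outProb t) atTop (𝓝 1) := by
  have := c.tendsto_Pr fun _ _ _ => True
  rw [Pr_true] at this
  simp only [if_true] at this
  exact this

theorem sum_exit_outProb (n : ℕ) : ∑ t ∈ Finset.range n, exitSum c.τ.Alive c.outProb t =
    1 - c.aliveProb n := by
  have := c.leafSum_outProb c.isTree_alive n
  rw [leafSum] at this
  rw [aliveProb]
  linarith

theorem tendsto_aliveProb : Tendsto c.aliveProb atTop (𝓝 0) := by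
  have := c.tendsto_sum_exit_outProb
  simp only [sum_exit_outProb] at this
  simpa using tendsto_const_nhds (x := (1 : ℝ)).sub this

/-- The mass of `m` is conserved in the tree, and the part still alive at length `n` is at most
`aliveProb n`, which tends to 0. -/
theorem Pr_message (m : M) : c.Pr (fun m' _ _ => m' = m) = (Fintype.card M : ℝ)⁻¹ := by
  classical
  have h1 := c.tendsto_Pr fun m' _ _ => m' = m
  have e : (fun (t : ℕ) (w : Fin t → Y) => ∑ m', if m' = m then c.msgProb m' t w else 0) =
      c.msgProb m := by
    ext t w
    simp
  have h2 : Tendsto (fun n => treeSum c.τ.Alive (c.msgProb m) n) atTop (𝓝 0) :=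
    squeeze_zero (fun n => treeSum_nonneg fun w _ => (c.msgProb_pos m n w).le)
      (fun n => treeSum_mono fun w _ => c.msgProb_le_outProb m n w) c.tendsto_aliveProb
  have h3 : Tendsto (fun n => ∑ t ∈ Finset.range n, exitSum c.τ.Alive (c.msgProb m) t) atTop
      (𝓝 (Fintype.card M : ℝ)⁻¹) := by
    have := (tendsto_const_nhds (x := (Fintype.card M : ℝ)⁻¹)).sub h2
    rw [sub_zero] at this
    refine this.congr fun n => ?_
    have := c.leafSum_msgProb c.isTree_alive m n
    rw [leafSum] at this
    linarith
  refine tendsto_nhds_unique h1 ?_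
  convert h3 using 4

end VLCode

/-! ### Conditional input distributions and one-step drifts. -/

section InputDist

open scoped Classical in
/-- The distribution of the letter `e m` when the message `m` has a probability proportional
to `g m`. -/
def inputDist (g : M → ℝ) (e : M → X) (x : X) : ℝ := (∑ m, if e m = x then g m else 0) / ∑ m, g m

theorem sum_inputDist_mul (g : M → ℝ) (e : M → X) (f : X → ℝ) :
    ∑ x, inputDist g e x * f x = (∑ m, g m * f (e m)) / ∑ m, g m := by
  classical
  simp only [inputDist, div_mul_eq_mul_div, ← Finset.sum_div, Finset.sum_mul]
  rw [Finset.sum_comm]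
  congr 1
  refine Finset.sum_congr rfl fun m _ => ?_
  simp

theorem inputDist_mem {g : M → ℝ} (e : M → X) (hg : ∀ m, 0 ≤ g m) (hs : 0 < ∑ m, g m) :
    inputDist g e ∈ stdSimplex ℝ X := by
  classical
  refine ⟨fun x => div_nonneg (Finset.sum_nonneg fun m _ => ?_) hs.le, ?_⟩
  · split_ifs
    exacts [hg m, le_rfl]
  · have := sum_inputDist_mul g e fun _ => 1
    simp only [mul_one] at this
    rw [this, div_self hs.ne']

theorem DMC.out_inputDist (W : DMC X Y) (g : M → ℝ) (e : M → X) (y : Y) :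
    W.out (inputDist g e) y = (∑ m, g m * W.prob (e m) y) / ∑ m, g m :=
  sum_inputDist_mul g e fun x => W.prob x y

end InputDist

namespace VLCode

variable {W : DMC X Y} (c : VLCode W M)

/-- The conditional distribution of the next input letter given the output word `w`. -/
def inDist (t : ℕ) (w : Fin t → Y) : X → ℝ :=
  inputDist (fun m => c.msgProb m t w) fun m => c.enc m t w

theorem inDist_mem (t : ℕ) (w : Fin t → Y) : c.inDist t w ∈ stdSimplex ℝ X :=
  inputDist_mem _ (fun m => (c.msgProb_pos m t w).le) (c.outProb_pos t w)

theorem outProb_wsnoc (t : ℕ) (w : Fin t → Y) (y : Y) :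
    c.outProb (t + 1) (wsnoc w y) = c.outProb t w * W.out (c.inDist t w) y := by
  rw [inDist, W.out_inputDist]
  change _ = c.outProb t w * (_ / c.outProb t w)
  rw [mul_div_cancel₀ _ (c.outProb_pos t w).ne']
  simp only [outProb, msgProb_wsnoc]

/-- The process is minus the posterior entropy, weighted by the word probability. The message acts
on the next output only through the input letter, so the gain of one step is the mutual information
at the conditional input law. -/
theorem drift_entropy (t : ℕ) (w : Fin t → Y) :
    drift (fun t w => ∑ m, c.msgProb m t w * Real.log (c.msgProb m t w / c.outProb t w)) t w =
      c.outProb t w * W.mutualInfo (c.inDist t w) := by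
  have hQ := c.outProb_pos t w
  have e : c.outProb t w * W.mutualInfo (c.inDist t w) =
      ∑ m, c.msgProb m t w * kl (W.prob (c.enc m t w)) (W.out (c.inDist t w)) := by
    rw [W.mutualInfo_eq]
    nth_rewrite 1 [inDist]
    rw [sum_inputDist_mul]
    change c.outProb t w * (_ / c.outProb t w) = _
    rw [mul_div_cancel₀ _ hQ.ne']
  rw [e, drift, Finset.sum_comm, ← Finset.sum_sub_distrib]
  refine Finset.sum_congr rfl fun m _ => ?_
  have hm := c.msgProb_pos m t w
  rw [sub_eq_iff_eq_add]
  have e1 : c.msgProb m t w * Real.log (c.msgProb m t w / c.outProb t w) =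
      ∑ y, c.msgProb m t w * W.prob (c.enc m t w) y *
        Real.log (c.msgProb m t w / c.outProb t w) := by
    rw [← Finset.sum_mul, ← Finset.mul_sum, W.sum_eq_one, mul_one]
  rw [e1, kl, Finset.mul_sum, ← Finset.sum_add_distrib]
  refine Finset.sum_congr rfl fun y _ => ?_
  have hW := W.pos (c.enc m t w) y
  have ho := W.out_pos (c.inDist_mem t w) y
  rw [msgProb_wsnoc, outProb_wsnoc, mul_div_mul_comm,
    Real.log_mul (div_pos hm hQ).ne' (div_pos hW ho).ne']
  ring

theorem drift_logRatio (m : M) (t : ℕ) (w : Fin t → Y) :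
    drift (fun t w => c.outProb t w * Real.log (c.outProb t w / W.wordProb (c.enc m) t w)) t w =
      c.outProb t w * kl (W.out (c.inDist t w)) (W.prob (c.enc m t w)) := by
  have hQ := c.outProb_pos t w
  have hP := W.wordProb_pos (c.enc m) t w
  rw [drift, sub_eq_iff_eq_add]
  have e1 : c.outProb t w * Real.log (c.outProb t w / W.wordProb (c.enc m) t w) =
      ∑ y, c.outProb t w * W.out (c.inDist t w) y *
        Real.log (c.outProb t w / W.wordProb (c.enc m) t w) := by
    rw [← Finset.sum_mul, ← Finset.mul_sum, W.sum_mul_prob, (c.inDist_mem t w).2, mul_one]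
  rw [e1, kl, Finset.mul_sum, ← Finset.sum_add_distrib]
  refine Finset.sum_congr rfl fun y _ => ?_
  have hW := W.pos (c.enc m t w) y
  have ho := W.out_pos (c.inDist_mem t w) y
  rw [W.wordProb_wsnoc, outProb_wsnoc, mul_div_mul_comm,
    Real.log_mul (div_pos hQ hP).ne' (div_pos ho hW).ne']
  ring

/-- The probability of the output word `w` and of a message other than `m`. -/
def otherProb (m : M) (t : ℕ) (w : Fin t → Y) : ℝ := c.outProb t w - c.msgProb m t w

theorem otherProb_eq [DecidableEq M] (m : M) (t : ℕ) (w : Fin t → Y) :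
    c.otherProb m t w = ∑ m', if m' = m then 0 else c.msgProb m' t w := by
  have : ∀ m', (if m' = m then 0 else c.msgProb m' t w) =
      c.msgProb m' t w - if m' = m then c.msgProb m' t w else 0 := by
    intro m'; split_ifs <;> simp
  simp only [this, Finset.sum_sub_distrib, otherProb, outProb]
  simp

theorem otherProb_nonneg (m : M) (t : ℕ) (w : Fin t → Y) : 0 ≤ c.otherProb m t w :=
  sub_nonneg.2 (c.msgProb_le_outProb m t w)

theorem otherProb_le (m : M) (t : ℕ) (w : Fin t → Y) : c.otherProb m t w ≤ c.outProb t w :=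
  sub_le_self _ (c.msgProb_pos m t w).le

theorem msgProb_le_otherProb {m m' : M} (h : m' ≠ m) (t : ℕ) (w : Fin t → Y) :
    c.msgProb m' t w ≤ c.otherProb m t w := by
  classical
  rw [otherProb_eq]
  have := Finset.single_le_sum (f := fun m' => if m' = m then 0 else c.msgProb m' t w)
    (fun m' _ => by split_ifs; exacts [le_rfl, (c.msgProb_pos _ _ _).le])
    (Finset.mem_univ m')
  simpa [h] using this

theorem otherProb_pos [Nontrivial M] (m : M) (t : ℕ) (w : Fin t → Y) : 0 < c.otherProb m t w := by
  obtain ⟨m', h⟩ := exists_ne m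
  exact (c.msgProb_pos m' t w).trans_le (c.msgProb_le_otherProb h t w)

theorem drift_otherProb (m : M) (t : ℕ) (w : Fin t → Y) : drift (c.otherProb m) t w = 0 := by
  simp only [drift, otherProb, Finset.sum_sub_distrib, sum_outProb_wsnoc, sum_msgProb_wsnoc,
    sub_self]

theorem exists_otherProb_wsnoc [Nontrivial M] (m : M) (t : ℕ) (w : Fin t → Y) :
    ∃ p ∈ stdSimplex ℝ X, ∀ y,
      c.otherProb m (t + 1) (wsnoc w y) = c.otherProb m t w * W.out p y := by
  classical
  have h0 := c.otherProb_pos m t w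
  rw [c.otherProb_eq] at h0
  refine ⟨_, inputDist_mem (fun m => c.enc m t w) (fun m' => ?_) h0, fun y => ?_⟩
  · split_ifs
    exacts [le_rfl, (c.msgProb_pos _ _ _).le]
  · rw [W.out_inputDist, otherProb_eq, otherProb_eq, mul_div_cancel₀ _ h0.ne']
    refine Finset.sum_congr rfl fun m' _ => ?_
    rw [msgProb_wsnoc]
    split_ifs <;> simp

/-- Given that the message is not `m`, the next output has the law of some input mixture; a row is
within `D` of every such mixture. -/
theorem drift_messageTest_le [Nontrivial M] (m : M) (t : ℕ) (w : Fin t → Y) :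
    drift (fun t w => c.msgProb m t w * Real.log (c.msgProb m t w / c.otherProb m t w)) t w ≤
      c.msgProb m t w * W.maxDiv := by
  obtain ⟨p, hp, ho⟩ := c.exists_otherProb_wsnoc m t w
  have hm := c.msgProb_pos m t w
  have hQ := c.otherProb_pos m t w
  refine le_trans (le_of_eq ?_) (mul_le_mul_of_nonneg_left (W.kl_prob_out_le hp (c.enc m t w)) hm.le)
  rw [drift, sub_eq_iff_eq_add]
  have e1 : c.msgProb m t w * Real.log (c.msgProb m t w / c.otherProb m t w) =
      ∑ y, c.msgProb m t w * W.prob (c.enc m t w) y *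
        Real.log (c.msgProb m t w / c.otherProb m t w) := by
    rw [← Finset.sum_mul, ← Finset.mul_sum, W.sum_eq_one, mul_one]
  rw [e1, kl, Finset.mul_sum, ← Finset.sum_add_distrib]
  refine Finset.sum_congr rfl fun y _ => ?_
  have hW := W.pos (c.enc m t w) y
  have ho' := W.out_pos hp y
  rw [msgProb_wsnoc, ho, mul_div_mul_comm,
    Real.log_mul (div_pos hm hQ).ne' (div_pos hW ho').ne']
  ring

/-- This limits the overshoot at locking: one step shrinks the mass of the other messages by at most
the factor `λ`. -/
theorem minProb_mul_otherProb_le (m : M) (t : ℕ) (w : Fin t → Y) (y : Y) :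
    W.minProb * c.otherProb m t w ≤ c.otherProb m (t + 1) (wsnoc w y) := by
  classical
  rw [otherProb_eq, otherProb_eq, Finset.mul_sum]
  refine Finset.sum_le_sum fun m' _ => ?_
  split_ifs
  · simp
  · rw [msgProb_wsnoc, mul_comm]
    exact mul_le_mul_of_nonneg_left (W.minProb_le _ _) (c.msgProb_pos _ _ _).le

theorem outProb_wsnoc_le (t : ℕ) (w : Fin t → Y) (y : Y) :
    c.outProb (t + 1) (wsnoc w y) ≤ c.outProb t w := by
  rw [← c.sum_outProb_wsnoc t w]
  exact Finset.single_le_sum (f := fun y => c.outProb (t + 1) (wsnoc w y))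
    (fun y _ => (c.outProb_pos _ _).le) (Finset.mem_univ y)

/-! ### Locking a message. -/

open scoped Classical in
/-- The first message whose posterior probability reaches `1 - δ`, as soon as there is one. -/
def lock (δ : ℝ) : (t : ℕ) → (Fin t → Y) → Option M
  | 0, _ => none
  | t + 1, w =>
    match lock δ t fun i => w i.castSucc with
    | some m => some m
    | none =>
      if h : ∃ m, (1 - δ) * c.outProb (t + 1) w ≤ c.msgProb m (t + 1) w then some h.choose else none

variable (δ : ℝ)

theorem lock_zero (w : Fin 0 → Y) : c.lock δ 0 w = none := rfl

open scoped Classical in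
theorem lock_wsnoc (t : ℕ) (w : Fin t → Y) (y : Y) :
    c.lock δ (t + 1) (wsnoc w y) =
      match c.lock δ t w with
      | some m => some m
      | none =>
        if h : ∃ m, (1 - δ) * c.outProb (t + 1) (wsnoc w y) ≤ c.msgProb m (t + 1) (wsnoc w y)
        then some h.choose else none := by
  have : (fun i : Fin t => wsnoc w y i.castSucc) = w := by ext; simp
  rw [lock, this]

variable {δ}

theorem lock_wsnoc_of_some {t : ℕ} {w : Fin t → Y} {m : M} (h : c.lock δ t w = some m) (y : Y) :
    c.lock δ (t + 1) (wsnoc w y) = some m := by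
  rw [lock_wsnoc, h]

theorem lock_of_wsnoc_none {t : ℕ} {w : Fin t → Y} {y : Y}
    (h : c.lock δ (t + 1) (wsnoc w y) = none) : c.lock δ t w = none := by
  by_contra h'
  obtain ⟨m, hm⟩ := Option.ne_none_iff_exists'.1 h'
  rw [c.lock_wsnoc_of_some hm] at h
  exact Option.some_ne_none _ h

theorem le_msgProb_of_lock {t : ℕ} {w : Fin t → Y} {y : Y} {m : M} (h : c.lock δ t w = none)
    (h' : c.lock δ (t + 1) (wsnoc w y) = some m) :
    (1 - δ) * c.outProb (t + 1) (wsnoc w y) ≤ c.msgProb m (t + 1) (wsnoc w y) := by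
  rw [lock_wsnoc, h] at h'
  dsimp only at h'
  split_ifs at h' with hex
  rw [Option.some.injEq] at h'
  rw [← h']
  exact hex.choose_spec

/-- Later lengths are covered by the definition of `lock`; the empty word is never tested, so the
uniform prior has to satisfy the bound by hypothesis. -/
theorem msgProb_le_of_lock_none (hM : (Fintype.card M : ℝ)⁻¹ ≤ 1 - δ) :
    ∀ {t : ℕ} {w : Fin t → Y}, c.lock δ t w = none → ∀ m,
      c.msgProb m t w ≤ (1 - δ) * c.outProb t w := by
  intro t
  cases t with
  | zero => intro w _ m; rw [msgProb_zero, outProb_zero, mul_one]; exact hM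
  | succ t =>
    intro w h m
    obtain ⟨w, y, rfl⟩ : ∃ (w' : Fin t → Y) (y : Y), w = wsnoc w' y :=
      ⟨fun i => w i.castSucc, w (Fin.last t), (Fin.snoc_init_self w).symm⟩
    have h' := c.lock_of_wsnoc_none h
    rw [lock_wsnoc, h'] at h
    dsimp only at h
    split_ifs at h with hex
    push Not at hex
    exact (hex m).le

variable (δ)

/-- The decoding time is not yet reached and no posterior probability has reached `1 - δ`. -/
def Undecided (t : ℕ) (w : Fin t → Y) : Prop := c.τ.Alive t w ∧ c.lock δ t w = none

theorem isTree_undecided : IsTree (c.Undecided δ) where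
  root w := ⟨c.isTree_alive.root w, rfl⟩
  init t w y h := ⟨c.isTree_alive.init t w y h.1, c.lock_of_wsnoc_none h.2⟩

end VLCode

/-! ### Decisions compared with locks, and the information gathered before locking. -/

namespace VLCode

variable {W : DMC X Y} (c : VLCode W M)

/-- The sum of `φ` over the words of length at most `n` at which the decoding time is reached. -/
def stopSum (φ : (t : ℕ) → (Fin t → Y) → ℝ) (n : ℕ) : ℝ :=
  ∑ t ∈ Finset.range n, exitSum c.τ.Alive φ t

theorem stopSum_mono {φ ψ : (t : ℕ) → (Fin t → Y) → ℝ} (h : ∀ t w, φ t w ≤ ψ t w) (n : ℕ) :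
    c.stopSum φ n ≤ c.stopSum ψ n :=
  Finset.sum_le_sum fun _ _ => exitSum_mono fun _ _ _ _ => h _ _

theorem stopSum_add (φ ψ : (t : ℕ) → (Fin t → Y) → ℝ) (n : ℕ) :
    c.stopSum (fun t w => φ t w + ψ t w) n = c.stopSum φ n + c.stopSum ψ n := by
  simp only [stopSum, exitSum_add, Finset.sum_add_distrib]

theorem stopSum_mul (a : ℝ) (φ : (t : ℕ) → (Fin t → Y) → ℝ) (n : ℕ) :
    c.stopSum (fun t w => a * φ t w) n = a * c.stopSum φ n := by
  simp only [stopSum, exitSum_mul, Finset.mul_sum]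

theorem stopSum_outProb (n : ℕ) : c.stopSum c.outProb n = 1 - c.aliveProb n := c.sum_exit_outProb n

/-- The probability of the output word `w` and of a wrong decision at its end. -/
def errProb (t : ℕ) (w : Fin t → Y) : ℝ := c.otherProb (c.dec t w) t w

theorem stopSum_errProb_le (n : ℕ) : c.stopSum c.errProb n ≤ c.Pe := by
  classical
  have := c.sum_exit_le_Pr (fun m t w => c.dec t w ≠ m) n
  have e : c.errProb = fun t w => ∑ m, if c.dec t w ≠ m then c.msgProb m t w else 0 := by
    ext t w
    rw [errProb, otherProb_eq]
    refine Finset.sum_congr rfl fun m _ => ?_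
    by_cases h : m = c.dec t w
    · simp [h]
    · simp [h, Ne.symm h]
  rw [stopSum, e]
  convert this
  rfl

theorem errProb_nonneg (t : ℕ) (w : Fin t → Y) : 0 ≤ c.errProb t w := c.otherProb_nonneg _ _ _

variable (δ : ℝ)

/-- The probability of the output word `w` if no message is locked at its end. -/
def openProb (t : ℕ) (w : Fin t → Y) : ℝ := (c.lock δ t w).elim (c.outProb t w) fun _ => 0

/-- The probability of the output word `w` if a message is locked at its end. -/
def lockedProb (t : ℕ) (w : Fin t → Y) : ℝ := (c.lock δ t w).elim 0 fun _ => c.outProb t w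

/-- The probability of the output word `w` and of a message other than the locked one. -/
def lockErrProb (t : ℕ) (w : Fin t → Y) : ℝ := (c.lock δ t w).elim 0 fun m => c.otherProb m t w

open scoped Classical in
/-- The probability of the output word `w` and of the locked message, if that is the decision. -/
def agreeProb (t : ℕ) (w : Fin t → Y) : ℝ :=
  (c.lock δ t w).elim 0 fun m => if m = c.dec t w then c.msgProb m t w else 0

variable {δ}

/-- If no message is locked when decoding, every decision is wrong with conditional probability at
least `δ`; this is Markov's inequality. -/
theorem stopSum_openProb_le (hδ : 0 < δ) (hM : (Fintype.card M : ℝ)⁻¹ ≤ 1 - δ) (n : ℕ) :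
    c.stopSum (c.openProb δ) n ≤ c.Pe / δ := by
  rw [le_div_iff₀ hδ, mul_comm, ← stopSum_mul]
  refine (c.stopSum_mono (fun t w => ?_) n).trans (c.stopSum_errProb_le n)
  rw [openProb]
  cases h : c.lock δ t w with
  | none =>
    have := c.msgProb_le_of_lock_none hM h (c.dec t w)
    simp only [Option.elim_none, errProb, otherProb]
    linarith
  | some m => simpa using c.errProb_nonneg t w

/-- The process `χ` is nonpositive when a lock occurs and has zero drift afterwards, so the locked
message is wrong with probability at most `δ`. -/
theorem stopSum_lockErrProb_le (hδ : 0 < δ) (n : ℕ) : c.stopSum (c.lockErrProb δ) n ≤ δ := by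
  let χ : (t : ℕ) → (Fin t → Y) → ℝ := fun t w =>
    (c.lock δ t w).elim 0 fun m => c.otherProb m t w - δ * c.outProb t w
  have hχ : leafSum c.τ.Alive χ n ≤ 0 := by
    have := leafSum_le c.isTree_alive (φ := χ) (b := fun _ _ => 0) (fun t w _ => ?_) n
    · have h0 : χ 0 Fin.elim0 = 0 := by simp [χ, lock_zero]
      simpa [h0, treeSum] using this
    · cases h : c.lock δ t w with
      | none =>
        simp only [drift, χ, h, Option.elim_none, sub_zero]
        refine Finset.sum_nonpos fun y _ => ?_
        cases h' : c.lock δ (t + 1) (wsnoc w y) with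
        | none => simp
        | some m =>
          have := c.le_msgProb_of_lock h h'
          simp only [Option.elim_some, otherProb]
          linarith
      | some m =>
        have h1 := c.drift_otherProb m t w
        have h2 := c.drift_outProb t w
        rw [drift] at h1 h2
        simp only [drift, χ, h, Option.elim_some, c.lock_wsnoc_of_some h, Finset.sum_sub_distrib,
          ← Finset.mul_sum]
        linear_combination h1 - δ * h2
  have h1 : leafSum c.τ.Alive (c.lockErrProb δ) n ≤
      leafSum c.τ.Alive (fun t w => χ t w + δ * c.outProb t w) n := by
    have : ∀ t w, c.lockErrProb δ t w ≤ χ t w + δ * c.outProb t w := by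
      intro t w
      have := (c.outProb_pos t w).le
      simp only [lockErrProb, χ]
      cases h : c.lock δ t w with
      | none => simp; positivity
      | some m => simp
    exact leafSum_mono (fun _ _ => this _ _) fun _ _ _ _ _ => this _ _
  rw [leafSum_add, leafSum_mul, c.leafSum_outProb c.isTree_alive] at h1
  have h2 : 0 ≤ treeSum c.τ.Alive (c.lockErrProb δ) n := treeSum_nonneg fun w _ => by
    rw [lockErrProb]
    cases h : c.lock δ n w with
    | none => simp
    | some m => exact c.otherProb_nonneg m n w
  rw [leafSum] at h1
  rw [stopSum]
  linarith

/-- A union bound: outside this event the decoder has not stopped, the decision is wrong, nothing is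
locked, or the locked message is wrong. -/
theorem le_stopSum_agreeProb (hδ : 0 < δ) (hM : (Fintype.card M : ℝ)⁻¹ ≤ 1 - δ) (n : ℕ) :
    1 - c.aliveProb n - c.Pe - c.Pe / δ - δ ≤ c.stopSum (c.agreeProb δ) n := by
  have h : ∀ t w, c.outProb t w ≤
      c.agreeProb δ t w + c.errProb t w + c.openProb δ t w + c.lockErrProb δ t w := by
    intro t w
    simp only [agreeProb, openProb, lockErrProb]
    cases h : c.lock δ t w with
    | none => simpa using c.errProb_nonneg t w
    | some m =>
      simp only [Option.elim_some]
      split_ifs with hm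
      · have := c.errProb_nonneg t w
        simp only [otherProb]
        linarith
      · have := c.msgProb_le_otherProb (Ne.symm hm) t w
        simp only [errProb] at *
        nth_rewrite 1 [otherProb]
        linarith
  have := c.stopSum_mono h n
  rw [stopSum_add, stopSum_add, stopSum_add, stopSum_outProb] at this
  linarith [c.stopSum_errProb_le n, c.stopSum_openProb_le hδ hM n, c.stopSum_lockErrProb_le hδ n]

theorem msgLog_ge (m : M) {a : ℝ} (ha : 0 < a) (t : ℕ) (w : Fin t → Y) :
    c.msgProb m t w * Real.log a + c.msgProb m t w - a * c.outProb t w ≤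
      c.msgProb m t w * Real.log (c.msgProb m t w / c.outProb t w) :=
  mul_log_div_ge (c.msgProb_pos m t w).le (c.outProb_pos t w) ha

theorem neg_outProb_mul_log_card_le (t : ℕ) (w : Fin t → Y) :
    -(c.outProb t w * Real.log (Fintype.card M)) ≤
      ∑ m, c.msgProb m t w * Real.log (c.msgProb m t w / c.outProb t w) := by
  have hc := c.card_pos
  refine le_trans (le_of_eq ?_)
    (Finset.sum_le_sum fun m _ => c.msgLog_ge m (inv_pos.2 hc) t w)
  rw [Finset.sum_sub_distrib, Finset.sum_add_distrib, ← Finset.sum_mul, Finset.sum_const,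
    Finset.card_univ, nsmul_eq_mul, Real.log_inv]
  change _ = c.outProb t w * _ + c.outProb t w - _
  field_simp
  ring

/-- Fano's inequality for a posterior with an atom of mass at least `1 - δ`. -/
theorem neg_outProb_mul_entropy_le (hδ : 0 < δ) (hδ' : δ ≤ 1 / 2) {m : M} {t : ℕ} {w : Fin t → Y}
    (hm : (1 - δ) * c.outProb t w ≤ c.msgProb m t w) :
    -(c.outProb t w * (Real.binEntropy δ + δ * Real.log (Fintype.card M))) ≤
      ∑ m, c.msgProb m t w * Real.log (c.msgProb m t w / c.outProb t w) := by
  classical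
  have hc := c.card_pos
  have hc1 : (1 : ℝ) ≤ Fintype.card M := by
    have : 0 < Fintype.card M := by exact_mod_cast hc
    exact_mod_cast this
  have hlog := Real.log_nonneg hc1
  have hQ := c.outProb_pos t w
  -- The comparison measure of Fano's inequality; total mass at most 1 is enough.
  let a : M → ℝ := fun m' => if m' = m then 1 - δ else δ / Fintype.card M
  have ha : ∀ m', 0 < a m' := by
    intro m'
    simp only [a]
    split_ifs
    · linarith
    · positivity
  have hsum : ∑ m', a m' ≤ 1 := by
    have : ∀ m', a m' ≤ (if m' = m then 1 - δ else 0) + δ / Fintype.card M := by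
      intro m'
      simp only [a]
      split_ifs
      · have : 0 ≤ δ / Fintype.card M := by positivity
        linarith
      · simp
    refine (Finset.sum_le_sum fun m' _ => this m').trans ?_
    rw [Finset.sum_add_distrib, Finset.sum_const, Finset.card_univ, nsmul_eq_mul,
      mul_div_cancel₀ _ hc.ne']
    simp
  refine le_trans ?_ (Finset.sum_le_sum fun m' _ => c.msgLog_ge m' (ha m') t w)
  rw [Finset.sum_sub_distrib, Finset.sum_add_distrib, ← Finset.sum_mul]
  have e1 : ∑ m', c.msgProb m' t w * Real.log (a m') =
      c.msgProb m t w * Real.log (1 - δ) +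
        c.otherProb m t w * (Real.log δ - Real.log (Fintype.card M)) := by
    have : ∀ m', c.msgProb m' t w * Real.log (a m') =
        (if m' = m then c.msgProb m' t w * Real.log (1 - δ) else 0) +
        (if m' = m then 0 else c.msgProb m' t w) * (Real.log δ - Real.log (Fintype.card M)) := by
      intro m'
      simp only [a]
      split_ifs
      · simp
      · rw [Real.log_div hδ.ne' hc.ne']; simp
    simp only [this, Finset.sum_add_distrib, ← Finset.sum_mul, c.otherProb_eq]
    simp
  rw [e1]
  change _ ≤ _ + c.outProb t w - _
  have h1 : (∑ m', a m') * c.outProb t w ≤ c.outProb t w := by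
    nlinarith
  have h2 : Real.log δ ≤ Real.log (1 - δ) := Real.log_le_log hδ (by linarith)
  have h3 : c.otherProb m t w ≤ δ * c.outProb t w := by rw [otherProb]; linarith
  have h4 : c.msgProb m t w = c.outProb t w - c.otherProb m t w := by rw [otherProb]; ring
  -- The bound is monotone in the mass of the other messages because `δ ≤ 1 - δ`, so that mass may
  -- be replaced by its maximum.
  have h5 : 0 ≤ (δ * c.outProb t w - c.otherProb m t w) *
      (Real.log (1 - δ) - Real.log δ + Real.log (Fintype.card M)) :=
    mul_nonneg (by linarith) (by linarith)
  rw [Real.binEntropy_eq_negMulLog_add_negMulLog_one_sub, Real.negMulLog, Real.negMulLog, h4]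
  nlinarith

/-- The information about the message gathered while the message is undecided. -/
theorem log_card_mul_le_sum_mutualInfo (hδ : 0 < δ) (hδ' : δ ≤ 1 / 2)
    (hM : (Fintype.card M : ℝ)⁻¹ ≤ 1 - δ) (n : ℕ) :
    Real.log (Fintype.card M) * (1 - δ - c.Pe / δ - c.aliveProb n) - Real.binEntropy δ ≤
      ∑ t ∈ Finset.range n, treeSum (c.Undecided δ)
        (fun t w => c.outProb t w * W.mutualInfo (c.inDist t w)) t := by
  have hc := c.card_pos
  have hlog : 0 ≤ Real.log (Fintype.card M) := by
    have : 0 < Fintype.card M := by exact_mod_cast hc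
    exact Real.log_nonneg (by exact_mod_cast this)
  have hH : 0 ≤ Real.binEntropy δ := Real.binEntropy_nonneg hδ.le (by linarith)
  let φ : (t : ℕ) → (Fin t → Y) → ℝ := fun t w =>
    ∑ m, c.msgProb m t w * Real.log (c.msgProb m t w / c.outProb t w)
  have h1 := leafSum_eq (c.isTree_undecided δ) φ n
  have h0 : φ 0 Fin.elim0 = -Real.log (Fintype.card M) := by
    simp only [φ, msgProb_zero, outProb_zero, div_one, Finset.sum_const, Finset.card_univ,
      nsmul_eq_mul, Real.log_inv]
    field_simp
  have hd : drift φ = fun t w => c.outProb t w * W.mutualInfo (c.inDist t w) := by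
    ext t w
    exact c.drift_entropy t w
  rw [hd, h0] at h1
  -- Locked leaves obey Fano's bound; at open ones only the trivial entropy bound `log |M|` is
  -- available.
  have h2 : leafSum (c.Undecided δ) (fun t w =>
      -(Real.binEntropy δ + δ * Real.log (Fintype.card M)) * c.outProb t w +
        -Real.log (Fintype.card M) * c.openProb δ t w) n ≤ leafSum (c.Undecided δ) φ n := by
    have hopen : ∀ t (w : Fin t → Y), c.lock δ t w = none →
        -(Real.binEntropy δ + δ * Real.log (Fintype.card M)) * c.outProb t w +
        -Real.log (Fintype.card M) * c.openProb δ t w ≤ φ t w := by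
      intro t w h
      refine le_trans ?_ (c.neg_outProb_mul_log_card_le t w)
      rw [openProb, h, Option.elim_none]
      have : 0 ≤ (Real.binEntropy δ + δ * Real.log (Fintype.card M)) * c.outProb t w :=
        mul_nonneg (by positivity) (c.outProb_pos t w).le
      linarith
    refine leafSum_mono (fun w hw => hopen n w hw.2) fun t w y hw _ => ?_
    cases h : c.lock δ (t + 1) (wsnoc w y) with
    | none => exact hopen _ _ h
    | some m =>
      refine le_trans (le_of_eq ?_)
        (c.neg_outProb_mul_entropy_le hδ hδ' (c.le_msgProb_of_lock hw.2 h))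
      rw [openProb, h, Option.elim_some]
      ring
  rw [leafSum_add, leafSum_mul, leafSum_mul, c.leafSum_outProb (c.isTree_undecided δ), h1] at h2
  -- An open leaf is still alive at length `n`, or decoding stops there without a lock.
  have h3 : leafSum (c.Undecided δ) (c.openProb δ) n ≤ c.aliveProb n + c.Pe / δ := by
    refine add_le_add ?_ ((Finset.sum_le_sum fun t _ => ?_).trans (c.stopSum_openProb_le hδ hM n))
    · refine Finset.sum_le_sum fun w _ => ?_
      by_cases hw : c.τ.Alive n w
      · simp only [Undecided, hw, true_and, if_true, openProb]
        have := (c.outProb_pos n w).le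
        cases h : c.lock δ n w <;> simp [this]
      · simp [Undecided, hw]
    · refine Finset.sum_le_sum fun w _ => Finset.sum_le_sum fun y _ => ?_
      have hQ := (c.outProb_pos (t + 1) (wsnoc w y)).le
      have hnn : 0 ≤ c.openProb δ (t + 1) (wsnoc w y) := by
        rw [openProb]
        cases h : c.lock δ (t + 1) (wsnoc w y) <;> simp [hQ]
      by_cases h : c.lock δ (t + 1) (wsnoc w y) = none
      · have h' := c.lock_of_wsnoc_none h
        by_cases ha : c.τ.Alive t w <;> by_cases hb : c.τ.Alive (t + 1) (wsnoc w y) <;>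
          simp [Undecided, h, h', ha, hb]
      · obtain ⟨m, hm⟩ := Option.ne_none_iff_exists'.1 h
        have : c.openProb δ (t + 1) (wsnoc w y) = 0 := by rw [openProb, hm]; rfl
        simp [this]
  nlinarith [mul_le_mul_of_nonneg_left h3 hlog]

end VLCode

/-! ### Hypothesis tests after locking and against the average message. -/

/-- The tangent with `c = 1/2`. The sharp constant is `1/e`; the weaker `1/2` suffices because the
loss is later covered by `log e ≤ -1/2` for `e ≤ 1/2`. -/
theorem neg_half_le_mul_log_div {x y : ℝ} (hx : 0 ≤ x) (hy : 0 < y) :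
    -(y / 2) ≤ x * Real.log (x / y) := by
  have h := mul_log_div_ge hx hy (show (0 : ℝ) < 2⁻¹ by norm_num)
  rw [Real.log_inv] at h
  have h2 : Real.log 2 < 1 := by linarith [Real.log_two_lt_d9]
  nlinarith

namespace VLCode

variable {W : DMC X Y} (c : VLCode W M)

theorem Pe_nonneg : 0 ≤ c.Pe := by
  have := c.stopSum_errProb_le 0
  simpa [stopSum] using this

theorem stopSum_pos_of_pos {φ ψ : (t : ℕ) → (Fin t → Y) → ℝ} (h0 : ∀ t w, 0 ≤ ψ t w)
    (h : ∀ t w, 0 < φ t w → 0 < ψ t w) {n : ℕ} (hφ : 0 < c.stopSum φ n) : 0 < c.stopSum ψ n := by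
  classical
  obtain ⟨t, ht, hlt⟩ : ∃ t ∈ Finset.range n, 0 < exitSum c.τ.Alive φ t := by
    by_contra! hne
    exact hφ.not_ge (Finset.sum_nonpos hne)
  refine Finset.sum_pos' (fun t _ => exitSum_nonneg fun w => h0 _ w) ⟨t, ht, ?_⟩
  have hnn : ∀ w y, 0 ≤ if c.τ.Alive t w ∧ ¬c.τ.Alive (t + 1) (wsnoc w y)
      then ψ (t + 1) (wsnoc w y) else 0 := by
    intro w y
    split_ifs
    exacts [h0 _ _, le_rfl]
  obtain ⟨w, hw⟩ : ∃ w : Fin t → Y, 0 < ∑ y, if c.τ.Alive t w ∧ ¬c.τ.Alive (t + 1) (wsnoc w y)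
      then φ (t + 1) (wsnoc w y) else 0 := by
    by_contra! hne
    exact hlt.not_ge (Finset.sum_nonpos fun w _ => hne w)
  obtain ⟨y, hy⟩ : ∃ y, 0 < if c.τ.Alive t w ∧ ¬c.τ.Alive (t + 1) (wsnoc w y)
      then φ (t + 1) (wsnoc w y) else 0 := by
    by_contra! hne
    exact hw.not_ge (Finset.sum_nonpos fun y _ => hne y)
  refine Finset.sum_pos' (fun w _ => Finset.sum_nonneg fun y _ => hnn w y)
    ⟨w, Finset.mem_univ w, Finset.sum_pos' (fun y _ => hnn w y) ⟨y, Finset.mem_univ y, ?_⟩⟩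
  split_ifs at hy ⊢
  · exact h _ _ hy
  · exact absurd hy (lt_irrefl _)

/-- All transition probabilities are positive, so another message could have produced any stopping
word. -/
theorem Pe_pos [Nontrivial M] : 0 < c.Pe := by
  obtain ⟨n, hn⟩ := (c.tendsto_sum_exit_outProb.eventually_const_lt zero_lt_one).exists
  exact (c.stopSum_pos_of_pos (c.errProb_nonneg) (fun t w _ => c.otherProb_pos _ t w) hn).trans_le
    (c.stopSum_errProb_le n)

variable {δ : ℝ}

/-- The test between the locked message and the others, after a message has been locked. -/
theorem lockedTest_le [Nontrivial M] (hδ : 0 < δ) (hδ' : δ ≤ 1 / 2)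
    (hM : (Fintype.card M : ℝ)⁻¹ ≤ 1 - δ) {a : ℝ} (ha : 0 < a) (n : ℕ) :
    (Real.log a + 3 / 2) * c.stopSum (c.agreeProb δ) n - a * c.Pe - 1 / 2 ≤
      -Real.log (W.minProb * δ) +
        W.maxDiv * ∑ t ∈ Finset.range n, treeSum c.τ.Alive (c.lockedProb δ) t := by
  have := c.nonempty_input
  have := c.nonempty_output
  obtain ⟨x⟩ := c.nonempty_input
  obtain ⟨y⟩ := c.nonempty_output
  have hD := W.maxDiv_nonneg
  have hl := W.minProb_pos
  have hl1 : W.minProb * δ ≤ 1 := by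
    nlinarith [(W.minProb_le x y).trans (W.prob_le_one x y)]
  have hL : Real.log (W.minProb * δ) ≤ 0 := Real.log_nonpos (by positivity) hl1
  set l := Real.log (W.minProb * δ) with hldef
  -- The added `l` pays for the initial log-likelihood ratio, at most `-l` at locking, so the
  -- process does not drift upwards before a lock.
  let φ : (t : ℕ) → (Fin t → Y) → ℝ := fun t w => (c.lock δ t w).elim 0 fun m =>
    c.msgProb m t w * Real.log (c.msgProb m t w / c.otherProb m t w) + c.outProb t w * l
  have hup := leafSum_le c.isTree_alive (φ := φ) (b := fun t w => W.maxDiv * c.lockedProb δ t w)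
    (fun t w _ => ?_) n
  · have h0 : φ 0 Fin.elim0 = 0 := by simp [φ, lock_zero]
    simp only [treeSum_mul, ← Finset.mul_sum, h0, zero_add] at hup
    have htree : treeSum c.τ.Alive (fun t w => (l - 1 / 2) * c.outProb t w) n ≤
        treeSum c.τ.Alive φ n := by
      refine treeSum_mono fun w _ => ?_
      have hQ := c.outProb_pos n w
      simp only [φ]
      cases h : c.lock δ n w with
      | none => simp only [Option.elim_none]; nlinarith
      | some m =>
        have h1 := neg_half_le_mul_log_div (c.msgProb_pos m n w).le (c.otherProb_pos m n w)
        have h2 := c.otherProb_le m n w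
        simp only [Option.elim_some]
        linarith
    -- On agreement the tangent of slope parameter `a` is used, elsewhere the bound `-1/2`. The
    -- latter is charged to every word, which gives `3/2 = 1 + 1/2` on agreement.
    have hexit : c.stopSum (fun t w => (Real.log a + 3 / 2) * c.agreeProb δ t w +
        -a * c.errProb t w + (l - 1 / 2) * c.outProb t w) n ≤ c.stopSum φ n := by
      refine c.stopSum_mono (fun t w => ?_) n
      have hQ := c.outProb_pos t w
      have hE := mul_nonneg ha.le (c.errProb_nonneg t w)
      simp only [φ, agreeProb]
      cases h : c.lock δ t w with
      | none => simp only [Option.elim_none]; nlinarith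
      | some m =>
        simp only [Option.elim_some]
        split_ifs with hm
        · have h1 := mul_log_div_ge (c.msgProb_pos m t w).le (c.otherProb_pos m t w) ha
          have h2 := c.msgProb_le_outProb m t w
          rw [errProb, ← hm]
          linarith
        · have h1 := neg_half_le_mul_log_div (c.msgProb_pos m t w).le (c.otherProb_pos m t w)
          have h2 := c.otherProb_le m t w
          linarith
    rw [stopSum_add, stopSum_add, stopSum_mul, stopSum_mul, stopSum_mul, stopSum_outProb] at hexit
    rw [treeSum_mul] at htree
    change (l - 1 / 2) * c.aliveProb n ≤ _ at htree
    have herr := mul_le_mul_of_nonneg_left (c.stopSum_errProb_le n) ha.le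
    rw [leafSum] at hup
    have e : c.stopSum φ n = ∑ t ∈ Finset.range n, exitSum c.τ.Alive φ t := rfl
    linarith
  · cases h : c.lock δ t w with
    | none =>
      simp only [drift, φ, lockedProb, h, Option.elim_none, sub_zero, mul_zero]
      refine Finset.sum_nonpos fun y _ => ?_
      cases h' : c.lock δ (t + 1) (wsnoc w y) with
      | none => simp
      | some m =>
        simp only [Option.elim_some]
        have hm := c.msgProb_pos m (t + 1) (wsnoc w y)
        have ho := c.otherProb_pos m (t + 1) (wsnoc w y)
        have hmQ := c.msgProb_le_outProb m (t + 1) (wsnoc w y)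
        have h1 := c.minProb_mul_otherProb_le m t w y
        have h2 : δ * c.outProb t w ≤ c.otherProb m t w := by
          have := c.msgProb_le_of_lock_none hM h m
          rw [otherProb]
          linarith
        have h3 := c.outProb_wsnoc_le t w y
        have h4 : W.minProb * δ * c.msgProb m (t + 1) (wsnoc w y) ≤
            c.otherProb m (t + 1) (wsnoc w y) := by
          calc _ ≤ W.minProb * δ * c.outProb t w :=
                mul_le_mul_of_nonneg_left (hmQ.trans h3) (by positivity)
            _ = W.minProb * (δ * c.outProb t w) := by ring
            _ ≤ W.minProb * c.otherProb m t w := mul_le_mul_of_nonneg_left h2 hl.le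
            _ ≤ _ := h1
        have h5 : Real.log (c.msgProb m (t + 1) (wsnoc w y) /
            c.otherProb m (t + 1) (wsnoc w y)) ≤ -l := by
          rw [hldef, ← Real.log_inv]
          refine Real.log_le_log (div_pos hm ho) ?_
          rw [div_le_iff₀ ho, ← div_eq_inv_mul, le_div_iff₀ (by positivity)]
          linarith
        nlinarith [mul_le_mul_of_nonneg_left h5 hm.le]
    | some m =>
      have h1 := c.drift_messageTest_le m t w
      have h2 := c.drift_outProb t w
      rw [drift] at h1 h2
      simp only [drift, φ, lockedProb, h, Option.elim_some, c.lock_wsnoc_of_some h,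
        Finset.sum_add_distrib, ← Finset.sum_mul]
      have h3 := mul_le_mul_of_nonneg_right (c.msgProb_le_outProb m t w) hD
      have h4 : (∑ y, c.outProb (t + 1) (wsnoc w y)) * l - c.outProb t w * l = 0 := by
        rw [← sub_mul, h2, zero_mul]
      linarith

/-- The probability of the output word `w`, if the decision is not `m`. -/
def rejectProb [DecidableEq M] (m : M) (t : ℕ) (w : Fin t → Y) : ℝ :=
  if c.dec t w = m then 0 else c.outProb t w

/-- The conditional probability of the output word `w` given `m`, if the decision is not `m`. -/
def missProb [DecidableEq M] (m : M) (t : ℕ) (w : Fin t → Y) : ℝ :=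
  if c.dec t w = m then 0 else W.wordProb (c.enc m) t w

theorem wordProb_eq (m : M) (t : ℕ) (w : Fin t → Y) :
    W.wordProb (c.enc m) t w = Fintype.card M * c.msgProb m t w := by
  rw [msgProb, mul_inv_cancel_left₀ c.card_pos.ne']

theorem stopSum_missProb_le [DecidableEq M] (m : M) (n : ℕ) :
    c.stopSum (c.missProb m) n ≤ c.PeOf m := by
  have h := c.sum_exit_le_Pr (fun m' t w => c.dec t w ≠ m' ∧ m' = m) n
  rw [PeOf, Pr_message, div_inv_eq_mul, mul_comm]
  have e : c.missProb m = fun t w => (Fintype.card M : ℝ) *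
      ∑ m', if c.dec t w ≠ m' ∧ m' = m then c.msgProb m' t w else 0 := by
    ext t w
    rw [missProb, wordProb_eq]
    split_ifs with hd
    · rw [Finset.sum_eq_zero, mul_zero]
      rintro m' -
      rw [if_neg]
      rintro ⟨h1, h2⟩
      exact h1 (hd.trans h2.symm)
    · rw [Finset.sum_eq_single m (fun m' _ hm' => by simp [hm']) (by simp)]
      simp [hd]
  rw [e, stopSum_mul]
  refine mul_le_mul_of_nonneg_left ?_ c.card_pos.le
  rw [stopSum]
  convert h
  rfl

/-- A decision for `m` is either wrong or made when `m` was sent, and the latter has probability at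
most `1/|M|`. -/
theorem le_stopSum_rejectProb [DecidableEq M] (m : M) (n : ℕ) :
    1 - c.aliveProb n - c.Pe - (Fintype.card M : ℝ)⁻¹ ≤ c.stopSum (c.rejectProb m) n := by
  have h := c.stopSum_mono (φ := c.outProb)
    (ψ := fun t w => c.rejectProb m t w + c.errProb t w + c.msgProb m t w) (fun t w => ?_) n
  · rw [stopSum_add, stopSum_add, stopSum_outProb] at h
    have h2 := c.leafSum_msgProb c.isTree_alive m n
    have h3 : 0 ≤ treeSum c.τ.Alive (c.msgProb m) n :=
      treeSum_nonneg fun w _ => (c.msgProb_pos m n w).le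
    rw [leafSum] at h2
    have h4 := c.stopSum_errProb_le n
    have h5 : c.stopSum (c.msgProb m) n =
      ∑ t ∈ Finset.range n, exitSum c.τ.Alive (c.msgProb m) t := rfl
    linarith
  · rw [rejectProb]
    split_ifs with hd
    · rw [errProb, hd, otherProb]
      linarith
    · linarith [c.errProb_nonneg t w, (c.msgProb_pos m t w).le]

/-- Some word that rejects `m` occurs, and by positivity of the channel it also occurs when `m` is
sent. -/
theorem PeOf_pos (h : c.Pe + (Fintype.card M : ℝ)⁻¹ < 1) (m : M) : 0 < c.PeOf m := by
  classical
  obtain ⟨n, hn⟩ := (c.tendsto_aliveProb.eventually_lt_const (sub_pos.2 h)).exists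
  refine (c.stopSum_pos_of_pos (φ := c.rejectProb m) (n := n) (fun t w => ?_) (fun t w hp => ?_)
    ?_).trans_le (c.stopSum_missProb_le m n)
  · rw [missProb]
    split_ifs
    exacts [le_rfl, (W.wordProb_pos _ _ _).le]
  · rw [rejectProb] at hp
    rw [missProb]
    split_ifs at hp ⊢
    · exact absurd hp (lt_irrefl _)
    · exact W.wordProb_pos _ _ _
  · linarith [c.le_stopSum_rejectProb m n]

/-- The test between the message `m` and the average message. -/
theorem averageTest_le [DecidableEq M] (δ : ℝ) (m : M) {a b : ℝ} (ha : 0 < a) (hb : 0 < b)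
    (n : ℕ) :
    (Real.log a - Real.log b) * c.stopSum (c.rejectProb m) n + Real.log b + 1 -
        a * c.PeOf m - b ≤
      ∑ t ∈ Finset.range n, treeSum (c.Undecided δ)
        (fun t w => c.outProb t w * kl (W.out (c.inDist t w)) (W.prob (c.enc m t w))) t +
      W.maxDiv * ∑ t ∈ Finset.range n, treeSum c.τ.Alive (c.lockedProb δ) t := by
  let φ : (t : ℕ) → (Fin t → Y) → ℝ := fun t w =>
    c.outProb t w * Real.log (c.outProb t w / W.wordProb (c.enc m) t w)
  have hup := leafSum_eq c.isTree_alive φ n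
  have h0 : φ 0 Fin.elim0 = 0 := by
    simp [φ, outProb_zero, DMC.wordProb]
  have hd : ∑ t ∈ Finset.range n, treeSum c.τ.Alive (drift φ) t ≤
      ∑ t ∈ Finset.range n, treeSum (c.Undecided δ)
        (fun t w => c.outProb t w * kl (W.out (c.inDist t w)) (W.prob (c.enc m t w))) t +
      W.maxDiv * ∑ t ∈ Finset.range n, treeSum c.τ.Alive (c.lockedProb δ) t := by
    rw [Finset.mul_sum, ← Finset.sum_add_distrib]
    refine Finset.sum_le_sum fun t _ => ?_
    rw [← treeSum_mul]
    simp only [treeSum]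
    rw [← Finset.sum_add_distrib]
    refine Finset.sum_le_sum fun w _ => ?_
    have hdr : drift φ t w = _ := c.drift_logRatio m t w
    by_cases hw : c.τ.Alive t w
    · cases h : c.lock δ t w with
      | none => simp [hw, Undecided, lockedProb, h, hdr]
      | some m' =>
        have := mul_le_mul_of_nonneg_left (W.kl_out_le (c.inDist_mem t w) (c.enc m t w))
          (c.outProb_pos t w).le
        simp only [hw, Undecided, lockedProb, h, hdr, if_true, true_and, Option.elim_some,
          reduceCtorEq, if_false, zero_add]
        linarith
    · simp [hw, Undecided]
  have hword : leafSum c.τ.Alive (fun t w => W.wordProb (c.enc m) t w) n = 1 := by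
    simp only [wordProb_eq]
    rw [leafSum_mul, c.leafSum_msgProb c.isTree_alive, mul_inv_cancel₀ c.card_pos.ne']
  have htree : treeSum c.τ.Alive (fun t w => (Real.log b + 1) * c.outProb t w +
      -b * W.wordProb (c.enc m) t w) n ≤ treeSum c.τ.Alive φ n := by
    refine treeSum_mono fun w _ => ?_
    have := mul_log_div_ge (c.outProb_pos n w).le (W.wordProb_pos (c.enc m) n w) hb
    simp only [φ]
    linarith
  -- Data processing for the event of rejecting `m`: slope parameter `a` on rejection and `b` on
  -- every other leaf.
  have hexit : c.stopSum (fun t w => (Real.log a - Real.log b) * c.rejectProb m t w +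
      -a * c.missProb m t w +
      ((Real.log b + 1) * c.outProb t w + -b * W.wordProb (c.enc m) t w)) n ≤ c.stopSum φ n := by
    refine c.stopSum_mono (fun t w => ?_) n
    have hP := W.wordProb_pos (c.enc m) t w
    have h1 := mul_log_div_ge (c.outProb_pos t w).le hP ha
    have h2 := mul_log_div_ge (c.outProb_pos t w).le hP hb
    simp only [φ, rejectProb, missProb]
    split_ifs
    · linarith
    · nlinarith
  rw [stopSum_add, stopSum_add, stopSum_mul, stopSum_mul] at hexit
  have hmiss := mul_le_mul_of_nonneg_left (c.stopSum_missProb_le m n) ha.le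
  have hrest : treeSum c.τ.Alive (fun t w => (Real.log b + 1) * c.outProb t w +
      -b * W.wordProb (c.enc m) t w) n + c.stopSum (fun t w => (Real.log b + 1) * c.outProb t w +
      -b * W.wordProb (c.enc m) t w) n = (Real.log b + 1) - b := by
    change leafSum c.τ.Alive _ n = _
    rw [leafSum_add, leafSum_mul, leafSum_mul, hword, c.leafSum_outProb c.isTree_alive]
    ring
  rw [leafSum, h0, zero_add] at hup
  have e : c.stopSum φ n = ∑ t ∈ Finset.range n, exitSum c.τ.Alive φ t := rfl
  linarith

end VLCode

/-! ### Elementary inequalities, the expected time, and the tests in the limit. -/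

theorem neg_binEntropy_le {s e : ℝ} (he : 0 < e) (he' : e ≤ 1 / 2) (hs : s ≤ e) :
    -Real.binEntropy e ≤ (1 - s) * Real.log (1 - e) + s * Real.log e := by
  have h := Real.log_le_log he (show e ≤ 1 - e by linarith)
  rw [Real.binEntropy_eq_negMulLog_add_negMulLog_one_sub, Real.negMulLog, Real.negMulLog]
  nlinarith [mul_nonneg (sub_nonneg.2 hs) (sub_nonneg.2 h)]

theorem log_le_neg_half {e : ℝ} (he : 0 < e) (he' : e ≤ 1 / 2) : Real.log e ≤ -(1 / 2) := by
  have h := Real.log_le_log he he'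
  rw [one_div, Real.log_inv] at h
  linarith [Real.log_two_gt_d9]

/-- This serves `maxDiv_pos`. At `k = 3` it amounts to `2 ^ 6 < 3 ^ 5`; from `k = 4` on, the first
half of the factor already gives `log 2`. -/
theorem log_two_lt_half_add_inv_mul_log {k : ℕ} (hk : 3 ≤ k) :
    Real.log 2 < (1 / 2 + (k : ℝ)⁻¹) * Real.log k := by
  have h3 : (3 : ℝ) ≤ k := by exact_mod_cast hk
  have hk0 : 0 < Real.log k := Real.log_pos (by linarith)
  rcases hk.eq_or_lt with rfl | hk
  · have h : Real.log ((2 : ℝ) ^ 6) < Real.log ((3 : ℝ) ^ 5) :=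
      Real.log_lt_log (by norm_num) (by norm_num)
    rw [Real.log_pow, Real.log_pow] at h
    push_cast at h ⊢
    linarith
  · have h4 : (4 : ℝ) ≤ k := by exact_mod_cast hk
    have h : Real.log ((2 : ℝ) ^ 2) ≤ Real.log k := Real.log_le_log (by norm_num) (by linarith)
    rw [Real.log_pow] at h
    push_cast at h
    have : 0 < (k : ℝ)⁻¹ * Real.log k := mul_pos (inv_pos.2 (by linarith)) hk0
    linarith

namespace VLCode

variable {W : DMC X Y} (c : VLCode W M)

/-- The tail-sum formula, by exchanging nonnegative sums; it also holds when the value is infinite.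
-/
theorem expTime_eq : c.expTime = ∑' u, ENNReal.ofReal (c.aliveProb u) := by
  have := c.nonempty_output
  set s : ℕ → ℝ := fun t => ∑ w : Fin t → Y, ∑ m, W.jointProb c.τ c.enc m t w with hs
  have hsum : HasSum s 1 := c.finite_time
  have hs0 : ∀ t, 0 ≤ s t := fun t => Finset.sum_nonneg fun w _ => Finset.sum_nonneg fun m _ => by
    rw [DMC.jointProb]
    split_ifs
    exacts [(c.msgProb_pos m t w).le, le_rfl]
  have hsucc : ∀ t, s (t + 1) = exitSum c.τ.Alive c.outProb t := by
    intro t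
    have := c.sum_jointProb_succ (fun _ _ _ => True) t
    simp only [if_true] at this
    exact this
  have hzero : s 0 = 0 := by simp [hs, DMC.jointProb, c.τ.not_stopsAt_zero]
  clear_value s
  have halive : ∀ u, HasSum (fun t => if u < t then s t else 0) (c.aliveProb u) := by
    intro u
    have h1 : HasSum (fun t => if t ∈ Finset.range (u + 1) then s t else 0)
        (∑ t ∈ Finset.range (u + 1), if t ∈ Finset.range (u + 1) then s t else 0) :=
      hasSum_sum_of_ne_finset_zero fun t ht => if_neg ht
    have h2 : c.aliveProb u =
        1 - ∑ t ∈ Finset.range (u + 1), if t ∈ Finset.range (u + 1) then s t else 0 := by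
      have := c.stopSum_outProb u
      rw [stopSum] at this
      rw [Finset.sum_congr rfl fun t ht => if_pos ht, Finset.sum_range_succ', hzero]
      simp only [hsucc, this]
      ring
    have h3 : (fun t => if u < t then s t else 0) =
        fun t => s t - if t ∈ Finset.range (u + 1) then s t else 0 := by
      ext t
      by_cases h : u < t
      · have : ¬t < u + 1 := by omega
        simp [h, this]
      · have : t < u + 1 := by omega
        simp [h, this]
    rw [h2, h3]
    exact hsum.sub h1
  have h1 : ∀ u, ENNReal.ofReal (c.aliveProb u) =
      ∑' t, if u < t then ENNReal.ofReal (s t) else 0 := by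
    intro u
    rw [← (halive u).tsum_eq, ENNReal.ofReal_tsum_of_nonneg _ (halive u).summable]
    · exact tsum_congr fun t => by split_ifs <;> simp
    · intro t
      split_ifs
      exacts [hs0 t, le_rfl]
  simp only [h1]
  rw [ENNReal.tsum_comm, expTime]
  refine tsum_congr fun t => ?_
  rw [tsum_eq_sum (s := Finset.range t) fun u hu => by
    rw [Finset.mem_range] at hu; rw [if_neg hu], Finset.sum_congr rfl fun u hu =>
    if_pos (Finset.mem_range.1 hu)]
  simp [hs]

theorem hasSum_aliveProb (h : c.expTime ≠ ⊤) : HasSum c.aliveProb c.expTime.toReal := by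
  have h' := h
  rw [expTime_eq] at h'
  have h1 := ENNReal.hasSum_toReal h'
  rw [← ENNReal.tsum_toReal_eq fun u => ENNReal.ofReal_ne_top, ← expTime_eq] at h1
  simpa [ENNReal.toReal_ofReal (c.aliveProb_nonneg _)] using h1

/-- At infinite expected time `toReal` is 0, and division by 0 gives the required 0. -/
theorem perTime_eq (a : ℝ) : c.perTime a = a / c.expTime.toReal := by
  rw [perTime, ENNReal.toReal_inv, div_eq_mul_inv]

variable {δ : ℝ}

theorem inv_card_pos (c : VLCode W M) : 0 < (Fintype.card M : ℝ)⁻¹ := inv_pos.2 c.card_pos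

theorem delta_lt_half (hδ : 0 < δ) (h : c.eps₁ δ ≤ 1 / 2) : δ < 1 / 2 := by
  have h1 := c.inv_card_pos
  have h2 := c.Pe_nonneg
  have h3 := div_nonneg h2 hδ.le
  rw [eps₁] at h
  linarith

theorem inv_card_lt_half (hδ : 0 < δ) (h : c.eps₁ δ ≤ 1 / 2) : (Fintype.card M : ℝ)⁻¹ < 1 / 2 := by
  have h2 := c.Pe_nonneg
  have h3 := div_nonneg h2 hδ.le
  rw [eps₁] at h
  linarith

theorem three_le_card (hδ : 0 < δ) (h : c.eps₁ δ ≤ 1 / 2) : 3 ≤ Fintype.card M := by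
  have h1 := c.inv_card_lt_half hδ h
  rw [inv_lt_comm₀ c.card_pos (by norm_num)] at h1
  have : (2 : ℝ) < Fintype.card M := by linarith
  exact_mod_cast this

theorem inv_card_le_one_sub (hδ : 0 < δ) (h : c.eps₁ δ ≤ 1 / 2) :
    (Fintype.card M : ℝ)⁻¹ ≤ 1 - δ := by
  linarith [c.delta_lt_half hδ h, c.inv_card_lt_half hδ h]

theorem nontrivial_message (hδ : 0 < δ) (h : c.eps₁ δ ≤ 1 / 2) : Nontrivial M := by
  rw [← Fintype.one_lt_card_iff_nontrivial]
  linarith [c.three_le_card hδ h]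

theorem eps₁_pos (hδ : 0 < δ) : 0 < c.eps₁ δ := by
  have h1 := c.inv_card_pos
  have h2 := c.Pe_nonneg
  have h3 := div_nonneg h2 hδ.le
  rw [eps₁]
  linarith

/-- If `D = 0`, no information is ever gathered, so `log |M| * (1 - δ - Pe / δ)` is at most `h(δ) ≤
log 2`. The smallness of `eps₁` makes the factor at least `1/2 + 1/|M|` and forces `|M| ≥ 3`, a
contradiction. -/
theorem maxDiv_pos (hδ : 0 < δ) (h : c.eps₁ δ ≤ 1 / 2) : 0 < W.maxDiv := by
  have := c.nonempty_input
  refine lt_of_le_of_ne W.maxDiv_nonneg fun hD => ?_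
  have hδ' := c.delta_lt_half hδ h
  have hinfo : ∀ n, Real.log (Fintype.card M) * (1 - δ - c.Pe / δ - c.aliveProb n) -
      Real.binEntropy δ ≤ 0 := by
    intro n
    refine (c.log_card_mul_le_sum_mutualInfo hδ hδ'.le (c.inv_card_le_one_sub hδ h) n).trans ?_
    refine Finset.sum_nonpos fun t _ => ?_
    have : treeSum (c.Undecided δ) (fun t w => c.outProb t w * W.mutualInfo (c.inDist t w)) t ≤
        treeSum (c.Undecided δ) (fun _ _ => 0) t := treeSum_mono fun w _ =>
      mul_nonpos_of_nonneg_of_nonpos (c.outProb_pos t w).le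
        (hD ▸ W.mutualInfo_le (c.inDist_mem t w))
    simpa [treeSum] using this
  have hlim : Tendsto (fun n => Real.log (Fintype.card M) * (1 - δ - c.Pe / δ - c.aliveProb n) -
      Real.binEntropy δ) atTop
      (𝓝 (Real.log (Fintype.card M) * (1 - δ - c.Pe / δ - 0) - Real.binEntropy δ)) :=
    ((c.tendsto_aliveProb.const_sub _).const_mul _).sub_const _
  have h1 := le_of_tendsto' hlim hinfo
  have h2 := log_two_lt_half_add_inv_mul_log (c.three_le_card hδ h)
  have h3 := Real.binEntropy_le_log_two (p := δ)
  have h4 : 0 ≤ Real.log (Fintype.card M) := Real.log_nonneg (by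
    have := c.three_le_card hδ h
    have : (3 : ℝ) ≤ Fintype.card M := by exact_mod_cast this
    linarith)
  have h5 : 1 / 2 + (Fintype.card M : ℝ)⁻¹ ≤ 1 - δ - c.Pe / δ := by
    have := c.Pe_nonneg
    rw [eps₁] at h
    linarith
  nlinarith [mul_le_mul_of_nonneg_left h5 h4]

/-- The bound on the error exponent by the time after a message has been locked. -/
theorem one_sub_mul_neg_log_Pe_le (hδ : 0 < δ) (h : c.eps₁ δ ≤ 1 / 2) {T : ℝ}
    (hT : ∀ n, ∑ t ∈ Finset.range n, treeSum c.τ.Alive (c.lockedProb δ) t ≤ T) :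
    (1 - c.eps₁ δ) * -Real.log c.Pe ≤
      Real.binEntropy (c.eps₁ δ) - Real.log (W.minProb * δ) + W.maxDiv * T := by
  have := c.nontrivial_message hδ h
  have := c.nonempty_input
  have hδ' := c.delta_lt_half hδ h
  have hM := c.inv_card_le_one_sub hδ h
  have hP := c.Pe_pos
  have he := c.eps₁_pos hδ
  have hc := c.inv_card_pos
  have hPe : c.Pe ≤ 1 - c.eps₁ δ := by
    have := div_nonneg hP.le hδ.le
    rw [eps₁] at h ⊢
    linarith
  set e := c.eps₁ δ with hedef
  -- The likelihood ratio of a binary test with success probability `1 - e` against `Pe`; it makes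
  -- the tangent bound produce `-log Pe`.
  have ha : 0 < (1 - e) / c.Pe := div_pos (by linarith) hP
  have hK : 0 ≤ Real.log ((1 - e) / c.Pe) := Real.log_nonneg ((one_le_div hP).2 hPe)
  have hn : ∀ n, (Real.log ((1 - e) / c.Pe) + 3 / 2) * (1 - e - c.aliveProb n) - (1 - e) - 1 / 2 ≤
      -Real.log (W.minProb * δ) + W.maxDiv * T := by
    intro n
    have h1 := c.lockedTest_le hδ hδ'.le hM ha n
    have h2 := c.le_stopSum_agreeProb hδ hM n
    have h3 : 1 - e - c.aliveProb n ≤ c.stopSum (c.agreeProb δ) n := by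
      rw [hedef, eps₁]
      linarith
    have h4 := mul_le_mul_of_nonneg_left h3
      (show 0 ≤ Real.log ((1 - e) / c.Pe) + 3 / 2 by linarith)
    have h5 := mul_le_mul_of_nonneg_left (hT n) W.maxDiv_nonneg
    rw [div_mul_cancel₀ _ hP.ne'] at h1
    linarith
  have hlim : Tendsto (fun n => (Real.log ((1 - e) / c.Pe) + 3 / 2) * (1 - e - c.aliveProb n) -
      (1 - e) - 1 / 2) atTop
      (𝓝 ((Real.log ((1 - e) / c.Pe) + 3 / 2) * (1 - e - 0) - (1 - e) - 1 / 2)) :=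
    (((c.tendsto_aliveProb.const_sub _).const_mul _).sub_const _).sub_const _
  have h1 := le_of_tendsto' hlim hn
  rw [Real.log_div (by linarith) hP.ne'] at h1
  have h2 := neg_binEntropy_le he h le_rfl
  -- The constants of the test leave `-e / 2`, which is at least the missing entropy term `e * log
  -- e`.
  have h3 := mul_le_mul_of_nonneg_left (log_le_neg_half he h) he.le
  linarith

/-- The bound on the error exponent of one message by the divergence from the average message. -/
theorem one_sub_mul_neg_log_PeOf_le (hδ : 0 < δ) (h : c.eps₁ δ ≤ 1 / 2) (m : M) {G T : ℝ}
    (hG : ∀ n, ∑ t ∈ Finset.range n, treeSum (c.Undecided δ)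
        (fun t w => c.outProb t w * kl (W.out (c.inDist t w)) (W.prob (c.enc m t w))) t ≤ G)
    (hT : ∀ n, ∑ t ∈ Finset.range n, treeSum c.τ.Alive (c.lockedProb δ) t ≤ T) :
    (1 - c.eps₁ δ) * -Real.log (c.PeOf m) ≤
      Real.binEntropy (c.eps₁ δ) + G + W.maxDiv * T := by
  classical
  have := c.nonempty_input
  have he := c.eps₁_pos hδ
  have hle : c.Pe + (Fintype.card M : ℝ)⁻¹ ≤ c.eps₁ δ := by
    have := div_nonneg c.Pe_nonneg hδ.le
    rw [eps₁]
    linarith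
  have hP := c.PeOf_pos (by linarith) m
  set e := c.eps₁ δ with hedef
  -- With this slope on rejection and `e` on acceptance, the tangent bounds add up to `-h(e) - (1 -
  -- e) * log (PeOf m)`.
  have ha : 0 < (1 - e) / c.PeOf m := div_pos (by linarith) hP
  have hP1 : c.PeOf m ≤ 1 := by
    rw [PeOf, c.Pr_message, div_le_one c.inv_card_pos, ← c.Pr_message m]
    refine le_of_tendsto_of_tendsto' (c.tendsto_Pr _) (c.tendsto_Pr _) fun n =>
      c.stopSum_mono (fun t w => Finset.sum_le_sum fun m' _ => ?_) n
    have := (c.msgProb_pos m' t w).le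
    by_cases h1 : m' = m
    · simp only [h1, and_true, if_true]
      split_ifs
      exacts [le_rfl, (c.msgProb_pos m t w).le]
    · simp [h1]
  have hk : 0 ≤ Real.log ((1 - e) / c.PeOf m) - Real.log e := by
    rw [sub_nonneg]
    refine Real.log_le_log he ?_
    rw [le_div_iff₀ hP]
    nlinarith
  have hn : ∀ n, (Real.log ((1 - e) / c.PeOf m) - Real.log e) * (1 - e - c.aliveProb n) +
      Real.log e + 1 - (1 - e) - e ≤ G + W.maxDiv * T := by
    intro n
    have h1 := c.averageTest_le δ m ha he n
    have h2 := c.le_stopSum_rejectProb m n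
    have h4 := mul_le_mul_of_nonneg_left
      (show 1 - e - c.aliveProb n ≤ c.stopSum (c.rejectProb m) n by linarith) hk
    have h5 := mul_le_mul_of_nonneg_left (hT n) W.maxDiv_nonneg
    rw [div_mul_cancel₀ _ hP.ne'] at h1
    linarith [hG n]
  have hlim : Tendsto (fun n => (Real.log ((1 - e) / c.PeOf m) - Real.log e) *
      (1 - e - c.aliveProb n) + Real.log e + 1 - (1 - e) - e) atTop
      (𝓝 ((Real.log ((1 - e) / c.PeOf m) - Real.log e) * (1 - e - 0) +
        Real.log e + 1 - (1 - e) - e)) :=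
    (((((c.tendsto_aliveProb.const_sub _).const_mul _).add_const _).add_const _).sub_const
      _).sub_const _
  have h1 := le_of_tendsto' hlim hn
  rw [Real.log_div (by linarith) hP.ne'] at h1
  have h2 := neg_binEntropy_le he h le_rfl
  linarith

end VLCode

/-! ### The two phases and the exchange of time between them. -/

namespace VLCode

variable {W : DMC X Y} (c : VLCode W M) (δ : ℝ)

theorem aliveProb_eq (t : ℕ) : c.aliveProb t =
    treeSum (c.Undecided δ) c.outProb t + treeSum c.τ.Alive (c.lockedProb δ) t := by
  simp only [aliveProb, treeSum]
  rw [← Finset.sum_add_distrib]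
  refine Finset.sum_congr rfl fun w _ => ?_
  by_cases hw : c.τ.Alive t w <;> cases h : c.lock δ t w <;> simp [Undecided, lockedProb, hw, h]

theorem treeSum_undecided_nonneg {f : (t : ℕ) → (Fin t → Y) → ℝ} (hf : ∀ t w, 0 ≤ f t w) (t : ℕ) :
    0 ≤ treeSum (c.Undecided δ) (fun t w => c.outProb t w * f t w) t :=
  treeSum_nonneg fun w _ => mul_nonneg (c.outProb_pos t w).le (hf t w)

theorem treeSum_undecided_le {f : (t : ℕ) → (Fin t → Y) → ℝ} {D : ℝ} (hf : ∀ t w, f t w ≤ D)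
    (t : ℕ) : treeSum (c.Undecided δ) (fun t w => c.outProb t w * f t w) t ≤
      D * treeSum (c.Undecided δ) c.outProb t := by
  rw [← treeSum_mul]
  refine treeSum_mono fun w _ => ?_
  rw [mul_comm]
  exact mul_le_mul_of_nonneg_right (hf t w) (c.outProb_pos t w).le

theorem treeSum_undecided_zero :
    treeSum (c.Undecided δ) c.outProb 0 = 1 := by
  have := c.leafSum_outProb (c.isTree_undecided δ) 0
  simpa [leafSum] using this

/-- Averages over the undecided words of the first `n` lengths are mixtures. -/
theorem undecided_mean_mem (m : M) {n : ℕ} (hn : 0 < n) :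
    ((∑ t ∈ Finset.range n, treeSum (c.Undecided δ)
        (fun t w => c.outProb t w * W.mutualInfo (c.inDist t w)) t) /
        ∑ t ∈ Finset.range n, treeSum (c.Undecided δ) c.outProb t,
      (∑ t ∈ Finset.range n, treeSum (c.Undecided δ)
        (fun t w => c.outProb t w * kl (W.out (c.inDist t w)) (W.prob (c.enc m t w))) t) /
        ∑ t ∈ Finset.range n, treeSum (c.Undecided δ) c.outProb t) ∈ dominated W.infoDivSet := by
  classical
  set U := ∑ t ∈ Finset.range n, treeSum (c.Undecided δ) c.outProb t with hU
  have hUpos : 0 < U := by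
    refine Finset.sum_pos' (fun t _ => treeSum_nonneg fun w _ => (c.outProb_pos t w).le)
      ⟨0, Finset.mem_range.2 hn, ?_⟩
    rw [treeSum_undecided_zero]
    exact one_pos
  let s : Finset (Σ t : ℕ, Fin t → Y) :=
    (Finset.range n).sigma fun t => Finset.univ.filter fun w => c.Undecided δ t w
  have hs : ∀ f : (t : ℕ) → (Fin t → Y) → ℝ,
      ∑ q ∈ s, c.outProb q.1 q.2 / U * f q.1 q.2 =
        (∑ t ∈ Finset.range n, treeSum (c.Undecided δ) (fun t w => c.outProb t w * f t w) t) / U := by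
    intro f
    rw [Finset.sum_sigma, Finset.sum_div]
    refine Finset.sum_congr rfl fun t _ => ?_
    rw [Finset.sum_filter, treeSum, Finset.sum_div]
    refine Finset.sum_congr rfl fun w _ => ?_
    split_ifs
    · ring
    · simp
  have := mean_mem_dominated (S := W.infoDivSet) s (fun q => c.outProb q.1 q.2 / U)
    (fun q => (W.mutualInfo (c.inDist q.1 q.2),
      kl (W.out (c.inDist q.1 q.2)) (W.prob (c.enc m q.1 q.2))))
    (fun q _ => div_nonneg (c.outProb_pos _ _).le hUpos.le)
    (by
      have := hs fun _ _ => 1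
      simp only [mul_one] at this
      rw [this]
      exact div_self hUpos.ne')
    (fun q _ => ⟨_, c.inDist_mem _ _, _, rfl⟩)
  rw [hs fun t w => W.mutualInfo (c.inDist t w),
    hs fun t w => kl (W.out (c.inDist t w)) (W.prob (c.enc m t w))] at this
  exact this

variable {δ}

/-- The split of the decoding time into the time `N₁` before and the time `N₂` after a message is
locked, with the information and the divergence gathered in the first part. -/
theorem exists_phases (hδ : 0 < δ) (h : c.eps₁ δ ≤ 1 / 2) (hfin : c.expTime ≠ ⊤) (m : M) :
    ∃ N₁ N₂ I G : ℝ, 1 ≤ N₁ ∧ 0 ≤ N₂ ∧ N₁ + N₂ = c.expTime.toReal ∧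
      (I / N₁, G / N₁) ∈ dominated W.infoDivSet ∧ I ≤ W.maxDiv * N₁ ∧ G ≤ W.maxDiv * N₁ ∧
      Real.log (Fintype.card M) * (1 - δ - c.Pe / δ) - Real.binEntropy δ ≤ I ∧
      (1 - c.eps₁ δ) * -Real.log c.Pe ≤
        Real.binEntropy (c.eps₁ δ) - Real.log (W.minProb * δ) + W.maxDiv * N₂ ∧
      (1 - c.eps₁ δ) * -Real.log (c.PeOf m) ≤
        Real.binEntropy (c.eps₁ δ) + G + W.maxDiv * N₂ := by
  have := c.nonempty_input
  have hδ' := c.delta_lt_half hδ h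
  let u : ℕ → ℝ := fun t => treeSum (c.Undecided δ) c.outProb t
  let l : ℕ → ℝ := fun t => treeSum c.τ.Alive (c.lockedProb δ) t
  let i : ℕ → ℝ := fun t => treeSum (c.Undecided δ)
    (fun t w => c.outProb t w * W.mutualInfo (c.inDist t w)) t
  let d : ℕ → ℝ := fun t => treeSum (c.Undecided δ)
    (fun t w => c.outProb t w * kl (W.out (c.inDist t w)) (W.prob (c.enc m t w))) t
  have hu0 : ∀ t, 0 ≤ u t := fun t => treeSum_nonneg fun w _ => (c.outProb_pos t w).le
  have hl0 : ∀ t, 0 ≤ l t := fun t => treeSum_nonneg fun w _ => by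
    rw [lockedProb]
    cases h : c.lock δ t w
    exacts [le_rfl, (c.outProb_pos t w).le]
  have hi0 : ∀ t, 0 ≤ i t :=
    c.treeSum_undecided_nonneg δ fun t w => W.mutualInfo_nonneg (c.inDist_mem t w)
  have hd0 : ∀ t, 0 ≤ d t :=
    c.treeSum_undecided_nonneg δ fun t w => W.kl_out_nonneg (c.inDist_mem t w) _
  have hiu : ∀ t, i t ≤ W.maxDiv * u t :=
    c.treeSum_undecided_le δ fun t w => W.mutualInfo_le (c.inDist_mem t w)
  have hdu : ∀ t, d t ≤ W.maxDiv * u t :=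
    c.treeSum_undecided_le δ fun t w => W.kl_out_le (c.inDist_mem t w) _
  have hsum := c.hasSum_aliveProb hfin
  have hul : ∀ t, c.aliveProb t = u t + l t := c.aliveProb_eq δ
  have hu : Summable u := .of_nonneg_of_le hu0
    (fun t => by linarith [hul t, hl0 t]) hsum.summable
  have hl : Summable l := .of_nonneg_of_le hl0
    (fun t => by linarith [hul t, hu0 t]) hsum.summable
  have hi : Summable i := .of_nonneg_of_le hi0 hiu (hu.mul_left _)
  have hd : Summable d := .of_nonneg_of_le hd0 hdu (hu.mul_left _)
  have hN₁ : 1 ≤ ∑' t, u t := by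
    have := hu.le_tsum 0 fun t _ => hu0 t
    rwa [show u 0 = 1 from c.treeSum_undecided_zero δ] at this
  refine ⟨∑' t, u t, ∑' t, l t, ∑' t, i t, ∑' t, d t, hN₁, tsum_nonneg hl0, ?_, ?_, ?_, ?_, ?_,
    ?_, ?_⟩
  · rw [← hu.tsum_add hl, ← hsum.tsum_eq]
    exact tsum_congr fun t => (hul t).symm
  -- For each finite length the averages are dominated by a mixture; closedness carries this to the
  -- full sums.
  · refine (isClosed_dominated W.isCompact_infoDivSet).mem_of_tendsto
      (((hi.hasSum.tendsto_sum_nat.div hu.hasSum.tendsto_sum_nat (by linarith)).prodMk_nhds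
      (hd.hasSum.tendsto_sum_nat.div hu.hasSum.tendsto_sum_nat (by linarith))))
      ((eventually_gt_atTop 0).mono fun n hn => c.undecided_mean_mem δ m hn)
  · rw [← tsum_mul_left]
    exact hi.tsum_le_tsum hiu (hu.mul_left _)
  · rw [← tsum_mul_left]
    exact hd.tsum_le_tsum hdu (hu.mul_left _)
  · have hlim : Tendsto (fun n => Real.log (Fintype.card M) *
        (1 - δ - c.Pe / δ - c.aliveProb n) - Real.binEntropy δ) atTop
        (𝓝 (Real.log (Fintype.card M) * (1 - δ - c.Pe / δ - 0) - Real.binEntropy δ)) :=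
      ((c.tendsto_aliveProb.const_sub _).const_mul _).sub_const _
    rw [sub_zero] at hlim
    exact le_of_tendsto_of_tendsto' hlim hi.hasSum.tendsto_sum_nat
      (c.log_card_mul_le_sum_mutualInfo hδ hδ'.le (c.inv_card_le_one_sub hδ h))
  · exact c.one_sub_mul_neg_log_Pe_le hδ h fun n => hl.sum_le_tsum _ fun t _ => hl0 t
  · exact c.one_sub_mul_neg_log_PeOf_le hδ h m (fun n => hd.sum_le_tsum _ fun t _ => hd0 t)
      fun n => hl.sum_le_tsum _ fun t _ => hl0 t

end VLCode

/-- Moving time from the second phase to the first one, at inputs that carry no information. -/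
theorem DMC.phase_tradeoff [Nonempty X] (W : DMC X Y) {η ν r a b : ℝ} (hν : ν < 1)
    (hη : η ≤ ν) (hab : (a, b) ∈ dominated W.infoDivSet) (hr : r ≤ (1 - ν) * a) :
    r / (1 - η) ≤ W.capacity ∧
      (1 - ν) * b + ν * W.maxDiv ≤ η * W.maxDiv + (1 - η) * W.J (r / (1 - η)) := by
  have h1 : 0 < 1 - η := by linarith
  -- Of the share `1 - η`, the first phase fills `1 - ν` at `(a, b)` and the remaining `ν - η` is
  -- spent at `(0, D)`; `η` may be negative.
  have hmem := convex_dominated W.infoDivSet hab W.zero_maxDiv_mem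
    (show 0 ≤ (1 - ν) / (1 - η) from div_nonneg (by linarith) h1.le)
    (show 0 ≤ (ν - η) / (1 - η) from div_nonneg (by linarith) h1.le)
    (by rw [← add_div, div_eq_one_iff_eq h1.ne']; ring)
  have hmem' : (r / (1 - η), ((1 - ν) * b + (ν - η) * W.maxDiv) / (1 - η)) ∈
      dominated W.infoDivSet := by
    refine dominated_mono_point hmem ?_ ?_
    · simp only [Prod.smul_mk, Prod.mk_add_mk, smul_eq_mul, mul_zero, add_zero]
      rw [div_mul_eq_mul_div]
      exact div_le_div_of_nonneg_right hr h1.le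
    · simp only [Prod.smul_mk, Prod.mk_add_mk, smul_eq_mul]
      rw [div_mul_eq_mul_div, div_mul_eq_mul_div, ← add_div]
  refine ⟨W.le_capacity hmem', ?_⟩
  have := W.le_J hmem'
  rw [div_le_iff₀ h1] at this
  linarith

end UEP

end
-- The final estimate.
theorem lemma7 {X Y M : Type*} [Fintype X] [Fintype Y] [Fintype M]
    (W : UEP.DMC X Y) (c : UEP.VLCode W M) (δ : ℝ) (hδ : 0 < δ)
    (h : c.Pe + δ + c.Pe / δ + (Fintype.card M : ℝ)⁻¹ ≤ 1 / 2) :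
    -- all terms of the bound are well defined
    0 < c.Pe ∧ 0 < W.maxDiv ∧
    0 < 1 - (c.exponent - c.eps δ) / W.maxDiv ∧
    (c.rate - c.eps δ) / (1 - (c.exponent - c.eps δ) / W.maxDiv) ≤ W.capacity ∧
    -- the bound
    ∀ m : M, 0 < c.PeOf m ∧
      c.perTime (-Real.log (c.PeOf m)) ≤
        c.exponent + (1 - (c.exponent - c.eps δ) / W.maxDiv) *
          W.J ((c.rate - c.eps δ) / (1 - (c.exponent - c.eps δ) / W.maxDiv)) := by
  have h' : c.eps₁ δ ≤ 1 / 2 := h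
  have := c.nontrivial_message hδ h'
  have := c.nonempty_input
  have := c.nonempty_output
  obtain ⟨m₀⟩ := c.nonempty_message
  have hD := c.maxDiv_pos hδ h'
  have hPe := c.Pe_pos
  have hδ' := c.delta_lt_half hδ h'
  have he := c.eps₁_pos hδ
  have hPm : ∀ m, 0 < c.PeOf m := c.PeOf_pos (by
    have := div_nonneg hPe.le hδ.le
    linarith)
  have hde : δ ≤ c.eps₁ δ := by
    have := div_nonneg hPe.le hδ.le
    have := c.inv_card_pos
    rw [UEP.VLCode.eps₁]
    linarith
  have hse : δ + c.Pe / δ ≤ c.eps₁ δ := by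
    have := c.inv_card_pos
    rw [UEP.VLCode.eps₁]
    linarith
  have hs0 : 0 ≤ δ + c.Pe / δ := add_nonneg hδ.le (div_nonneg hPe.le hδ.le)
  have hH : Real.binEntropy δ ≤ Real.binEntropy (c.eps₁ δ) :=
    Real.binEntropy_strictMonoOn.monotoneOn ⟨hδ.le, by linarith⟩ ⟨he.le, by linarith⟩ hde
  have hH0 : 0 ≤ Real.binEntropy δ := Real.binEntropy_nonneg hδ.le (by linarith)
  have hL : Real.log (W.minProb * δ) ≤ 0 := by
    obtain ⟨x⟩ := c.nonempty_input
    obtain ⟨y⟩ := c.nonempty_output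
    have hl := W.minProb_pos
    refine Real.log_nonpos (by positivity) ?_
    nlinarith [(W.minProb_le x y).trans (W.prob_le_one x y)]
  have key : 0 < 1 - (c.exponent - c.eps δ) / W.maxDiv ∧
      ∀ m, (c.rate - c.eps δ) / (1 - (c.exponent - c.eps δ) / W.maxDiv) ≤ W.capacity ∧
      c.perTime (-Real.log (c.PeOf m)) ≤
        c.exponent + (1 - (c.exponent - c.eps δ) / W.maxDiv) *
          W.J ((c.rate - c.eps δ) / (1 - (c.exponent - c.eps δ) / W.maxDiv)) := by
    -- At infinite expected time `R`, `E` and the left side are 0 and `ε > 0`; the tradeoff with `ν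
    -- = 0` at the point `(0, D)` gives everything.
    by_cases hfin : c.expTime = ⊤
    · have hper : ∀ a, c.perTime a = 0 := fun a => by simp [UEP.VLCode.perTime, hfin]
      have heps : 0 < c.eps δ := by
        rw [UEP.VLCode.eps, UEP.VLCode.eps₂, hper, add_zero]
        exact div_pos (mul_pos he hD) (by linarith)
      have hη : (0 - c.eps δ) / W.maxDiv < 0 := div_neg_of_neg_of_pos (by linarith) hD
      simp only [UEP.VLCode.exponent, UEP.VLCode.rate, hper]
      have := W.phase_tradeoff (r := 0 - c.eps δ) zero_lt_one hη.le W.zero_maxDiv_mem (by linarith)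
      refine ⟨by linarith, fun m => ⟨this.1, ?_⟩⟩
      have h2 := this.2
      have h3 := mul_neg_of_neg_of_pos hη hD
      linarith
    · have hgen : ∀ m, 0 < 1 - (c.exponent - c.eps δ) / W.maxDiv ∧
          (c.rate - c.eps δ) / (1 - (c.exponent - c.eps δ) / W.maxDiv) ≤ W.capacity ∧
          c.perTime (-Real.log (c.PeOf m)) ≤
            c.exponent + (1 - (c.exponent - c.eps δ) / W.maxDiv) *
              W.J ((c.rate - c.eps δ) / (1 - (c.exponent - c.eps δ) / W.maxDiv)) := by
        intro m
        obtain ⟨N₁, N₂, I, G, hN₁, hN₂, hT, hmem, hI, hG, hinfo, hexp, hmiss⟩ :=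
          c.exists_phases hδ h' hfin m
        set T := c.expTime.toReal with hTdef
        set e := c.eps₁ δ with hedef
        have hTpos : 0 < T := by linarith
        have hT0 : T ≠ 0 := hTpos.ne'
        have hN0 : N₁ ≠ 0 := by linarith
        have h1e : 0 < 1 - e := by linarith
        -- This is what `ε` is made for. The entropy and `log (λδ)` terms cancel those of the tests,
        -- and `T * e * D` pays for dividing by `1 - e`, since `D * N₂`, `I` and `G + D * N₂` are
        -- all at most `D * T`.
        have heps : (1 - e) * (T * c.eps δ) =
            T * (e * W.maxDiv) + (Real.binEntropy e - Real.log (W.minProb * δ)) := by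
          rw [UEP.VLCode.eps, UEP.VLCode.eps₂, c.perTime_eq, ← hTdef, ← hedef]
          field_simp
        have hexponent : T * c.exponent = -Real.log c.Pe := by
          rw [UEP.VLCode.exponent, c.perTime_eq, ← hTdef]
          field_simp
        have hrate : T * c.rate = Real.log (Fintype.card M) := by
          rw [UEP.VLCode.rate, c.perTime_eq, ← hTdef]
          field_simp
        have hmissTime : T * c.perTime (-Real.log (c.PeOf m)) = -Real.log (c.PeOf m) := by
          rw [c.perTime_eq, ← hTdef]
          field_simp
        have hν : N₂ / T < 1 := by
          rw [div_lt_one hTpos]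
          linarith
        have hη : (c.exponent - c.eps δ) / W.maxDiv ≤ N₂ / T := by
          rw [div_le_div_iff₀ hD hTpos]
          have hb : N₂ ≤ T := by linarith
          have : (1 - e) * (T * c.exponent - T * c.eps δ) ≤ (1 - e) * (W.maxDiv * N₂) := by
            rw [mul_sub, heps, hexponent]
            have := mul_le_mul_of_nonneg_left hb (mul_nonneg he.le hD.le)
            linarith
          have := le_of_mul_le_mul_left this h1e
          linarith
        have hr : c.rate - c.eps δ ≤ (1 - N₂ / T) * (I / N₁) := by
          have e1 : (1 - N₂ / T) * (I / N₁) = I / T := by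
            rw [← hT]
            have : N₁ + N₂ ≠ 0 := by rwa [hT]
            field_simp
            ring
          rw [e1, le_div_iff₀ hTpos]
          have hlog : 0 ≤ Real.log (Fintype.card M) := Real.log_nonneg (by
            have := c.three_le_card hδ h'
            have : (3 : ℝ) ≤ Fintype.card M := by exact_mod_cast this
            linarith)
          have h1 : Real.log (Fintype.card M) * (1 - e) ≤ I + Real.binEntropy δ := by
            have := mul_le_mul_of_nonneg_left hse hlog
            linarith
          have h2 : I ≤ W.maxDiv * T := hI.trans (mul_le_mul_of_nonneg_left (by linarith) hD.le)
          have h3 : Real.log (Fintype.card M) ≤ I + Real.binEntropy δ +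
              Real.log (Fintype.card M) * e := by linarith
          have h4 : (1 - e) * (Real.log (Fintype.card M) - T * c.eps δ) ≤ (1 - e) * I := by
            rw [mul_sub, heps]
            have := mul_le_mul_of_nonneg_left h2 he.le
            linarith
          have := le_of_mul_le_mul_left h4 h1e
          linarith
        -- Used with `ν = N₂ / T`, the true share of the locked phase, and `η = (E - ε) / D`, its
        -- lower bound.
        have htr := W.phase_tradeoff hν hη hmem hr
        refine ⟨by linarith, htr.1, ?_⟩
        have h2 := htr.2
        rw [div_mul_cancel₀ _ hD.ne'] at h2
        refine le_of_mul_le_mul_left ?_ hTpos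
        refine le_trans ?_ (mul_le_mul_of_nonneg_left
          (show (1 - N₂ / T) * (G / N₁) + N₂ / T * W.maxDiv + c.eps δ ≤ _ by
            linarith only [h2]) hTpos.le)
        have e1 : T * ((1 - N₂ / T) * (G / N₁) + N₂ / T * W.maxDiv + c.eps δ) =
            G + N₂ * W.maxDiv + T * c.eps δ := by
          rw [← hT]
          have : N₁ + N₂ ≠ 0 := by rwa [hT]
          field_simp
          ring
        rw [e1, hmissTime]
        refine le_of_mul_le_mul_left ?_ h1e
        rw [mul_add, heps]
        have h3 : e * (G + N₂ * W.maxDiv) ≤ e * (T * W.maxDiv) := by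
          refine mul_le_mul_of_nonneg_left ?_ he.le
          rw [← hT]
          linarith
        linarith
      exact ⟨(hgen m₀).1, fun m => (hgen m).2⟩
  exact ⟨hPe, hD, key.1, (key.2 m₀).1, fun m => ⟨hPm m, (key.2 m).2⟩⟩
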